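/- Let $d\ge 1$, let $\mathbb{T}^d=\mathbb{R}^d/\mathbb{Z}^d$ carry the normalized Lebesgue measure $\mu$ and the distance induced by the Euclidean distance of $\mathbb{R}^d$, and write $\widehat f(k)=\int_{\mathbb{T}^d}f(x)e^{-2\pi i k\cdot x}\,dx$ for $k\in\mathbb{Z}^d$. Let $w:\mathbb{R}^d\to\mathbb{R}$ be a smooth radial function with $w(\xi)=0$ for $|\xi|\ge 1/2$ and $\int_{\mathbb{R}^d}w(\xi)^2\,d\xi=1$ (such functions exist). Put $$K(x)=\int_{\mathbb{R}^d}\left(1+|\xi|^2\right)^{-(d+1)/2}(w*w)(\xi)\,e^{2\pi i\xi\cdot x}\,d\xi,\qquad I(t)=\int_{\{|x|\ge t\}}K(x)\,dx,$$ $$\gamma^{-1}=e^{-2\pi}\int_{\{|y|\le 1\}}K(y)\,dy,\qquad \psi(t)=4\gamma\, I(t/2)\quad(t\ge 0).$$ Then $\psi$ is positive on $[0,\infty)$ and has fast decay: for every $\alpha\in\mathbb{R}$ there is a constant $c(\alpha)$ with $\psi(t)\le c(\alpha)(1+t)^{-\alpha}$ for all $t\ge 0$. Moreover, for every $m\ge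 1$, all points $x_1,\dots,x_m\in\mathbb{T}^d$, every measurable set $\Omega\subseteq\mathbb{T}^d$ and every real $R>0$, setting $$H_R(x)=\tfrac14\,\psi\bigl(2R\operatorname{dist}(x,\partial\Omega)\bigr)$$ (with $H_R=0$ if $\partial\Omega=\emptyset$, i.e. $\operatorname{dist}(x,\emptyset)=\infty$ and $\psi(\infty)=0$), one has $$\left|\mu(\Omega)-\frac1m\sum_{j=1}^m\chi_\Omega(x_j)\right|\le\left|\widehat{H}_R(0)\right|+\sum_{k\in\mathbb{Z}^d,\ 0<|k|<R}\left(\left|\widehat{\chi}_\Omega(k)\right|+\left|\widehat{H}_R(k)\right|\right)\left|\frac1m\sum_{j=1}^m e^{2\pi i k\cdot x_j}\right|,$$ where $|k|$ is the Euclidean norm. -/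

import Mathlib

open MeasureTheory
open scoped FourierTransform Convolution

noncomputable section

namespace ErdosTuran

/-- The multiplier profiles: real-valued smooth radial functions on `ℝ^d` that vanish for
`|ξ| ≥ 1/2` and satisfy `∫ w² = 1`. -/
structure IsProfile {d : ℕ} (w : EuclideanSpace ℝ (Fin d) → ℝ) : Prop where
  smooth : ContDiff ℝ ((⊤ : ℕ∞) : WithTop ℕ∞) w
  radial : ∀ ξ η, ‖ξ‖ = ‖η‖ → w ξ = w η
  eq_zero : ∀ ξ, 1 / 2 ≤ ‖ξ‖ → w ξ = 0
  integral_sq : ∫ ξ, w ξ ^ 2 = 1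

/-- `K̂(ξ) = (1 + |ξ|²)^{-(d+1)/2} (w * w)(ξ)`. -/
def kernelHat {d : ℕ} (w : EuclideanSpace ℝ (Fin d) → ℝ) (ξ : EuclideanSpace ℝ (Fin d)) : ℝ :=
  (1 + ‖ξ‖ ^ 2) ^ (-((d : ℝ) + 1) / 2) * (w ⋆[ContinuousLinearMap.mul ℝ ℝ, volume] w) ξ

/-- `K(x) = ∫ K̂(ξ) e^{2πi ξ·x} dξ`. The integral is real when `w` is radial, since `K̂` is then
real and even; the real part only records this in the type. -/
def kernel {d : ℕ} (w : EuclideanSpace ℝ (Fin d) → ℝ) (x : EuclideanSpace ℝ (Fin d)) : ℝ :=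
  ((𝓕⁻ (fun ξ : EuclideanSpace ℝ (Fin d) => (kernelHat w ξ : ℂ))) x).re

/-- `I(t) = ∫_{|x| ≥ t} K(x) dx`. -/
def tail {d : ℕ} (w : EuclideanSpace ℝ (Fin d) → ℝ) (t : ℝ) : ℝ :=
  ∫ x in {x : EuclideanSpace ℝ (Fin d) | t ≤ ‖x‖}, kernel w x

/-- The constant `γ` with `γ⁻¹ = e^{-2π} ∫_{|y| ≤ 1} K(y) dy`. -/
def gam {d : ℕ} (w : EuclideanSpace ℝ (Fin d) → ℝ) : ℝ :=
  (Real.exp (-(2 * Real.pi)) *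
    ∫ y in {y : EuclideanSpace ℝ (Fin d) | ‖y‖ ≤ 1}, kernel w y)⁻¹

/-- `ψ(t) = 4 γ I(t/2)`. -/
def psi {d : ℕ} (w : EuclideanSpace ℝ (Fin d) → ℝ) (t : ℝ) : ℝ :=
  4 * gam w * tail w (t / 2)

/-- The distance from `x` to `S` in the flat torus `ℝ^d/ℤ^d`. The `ℓ²` product metric on
`(ℝ/ℤ)^d` is the quotient of the Euclidean metric of `ℝ^d`; the metric that `UnitAddTorus` itself
carries in the library is the sup metric. -/
def torusInfDist {d : ℕ} (x : UnitAddTorus (Fin d)) (S : Set (UnitAddTorus (Fin d))) : ℝ :=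
  Metric.infDist (WithLp.toLp 2 x : PiLp 2 (fun _ : Fin d => UnitAddCircle))
    ((fun y => (WithLp.toLp 2 y : PiLp 2 (fun _ : Fin d => UnitAddCircle))) '' S)

open Classical in
/-- `H_R(x) = ψ(2 R dist(x, ∂Ω)) / 4`. If `∂Ω` is empty, the distance is infinite and the value
is `ψ(∞) / 4 = 0`. -/
def boundaryTerm {d : ℕ} (w : EuclideanSpace ℝ (Fin d) → ℝ) (Ω : Set (UnitAddTorus (Fin d)))
    (R : ℝ) (x : UnitAddTorus (Fin d)) : ℝ :=
  if (frontier Ω).Nonempty then psi w (2 * R * torusInfDist x (frontier Ω)) / 4 else 0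

/-- The Euclidean length `|k|` of a frequency `k ∈ ℤ^d`. -/
def freqNorm {d : ℕ} (k : Fin d → ℤ) : ℝ :=
  ‖(WithLp.toLp 2 (fun i => (k i : ℝ)) : EuclideanSpace ℝ (Fin d))‖

theorem finite_freqs (d : ℕ) (R : ℝ) :
    {k : Fin d → ℤ | 0 < freqNorm k ∧ freqNorm k < R}.Finite := by
  refine (Set.Finite.pi' (fun _ : Fin d => Set.finite_Icc (-⌈R⌉) ⌈R⌉)).subset ?_
  intro k hk i
  have h1 : |(k i : ℝ)| ≤ freqNorm k :=
    PiLp.norm_apply_le (WithLp.toLp 2 (fun i => (k i : ℝ)) : EuclideanSpace ℝ (Fin d)) i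
  have h2 : |(k i : ℝ)| ≤ ((⌈R⌉ : ℤ) : ℝ) := (h1.trans hk.2.le).trans (Int.le_ceil R)
  rw [abs_le] at h2
  exact ⟨by exact_mod_cast h2.1, by exact_mod_cast h2.2⟩

/-- The finite set of frequencies `k ∈ ℤ^d` with `0 < |k| < R`. -/
def freqs (d : ℕ) (R : ℝ) : Finset (Fin d → ℤ) := (finite_freqs d R).toFinset

/-- The `k`-th Fourier coefficient `∫ f(x) e^{-2πi k·x} dx` of a real function on the torus. -/
def coeff {d : ℕ} (f : UnitAddTorus (Fin d) → ℝ) (k : Fin d → ℤ) : ℂ :=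
  UnitAddTorus.mFourierCoeff (fun x => (f x : ℂ)) k

end ErdosTuran

end

/-! The kernel `K` is a positive, band-limited approximate identity with a Harnack inequality. Its
transform is a product: `w * w` is the transform of a square, and `(1 + |ξ|²)^{-(d+1)/2}` is, up to
a positive constant, the transform of `e^{-2π|x|}`. So `K` is a positive multiple of `e^{-2π|·|}`
convolved with `ŵ²`. Hence `K > 0`, and the triangle inequality in the exponent gives `K(x+e) ≥
e^{-2π|e|} K(x)` (`exp_mul_kernel_le`). In polar coordinates this becomes `I(t+1) ≥ e^{-2π} I(t)`
(`exp_mul_tail_le`).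

Let `S f(x)` be the average of `f(x - y/R)` over `y` with density `K`. As `K̂` vanishes for `|ξ| ≥
1`, equals 1 at 0 and is bounded by 1, `S f` is a trigonometric polynomial with frequencies `|k| <
R`, mean `f̂(0)` and coefficients at most `|f̂(k)|` (`ofReal_smoothing`).

A translation shorter than `dist(x, ∂Ω)` cannot cross the boundary, so `|χ - Sχ| ≤ I(R dist(x,
∂Ω))`. By the unit-shift bound and the choice of `γ`, this is at most `S H_R`
(`tail_le_smoothing_boundaryTerm`). The inequality `|χ - Sχ| ≤ S H_R` holds at every point;
averaging it over the `x_j` and expanding both smoothings yields the theorem. -/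

namespace ErdosTuran

/-! ### Gaussian subordination and the Fourier transform of `exp (-2π‖x‖)` -/

open Real Set in
/-- The Cauchy–Schlömilch substitution `v = u - a / u` in the Gaussian integral. -/
theorem integral_exp_neg_sub_div_sq {a : ℝ} (ha : 0 < a) :
    ∫ u in Ioi (0 : ℝ), 2 * rexp (-(u - a / u) ^ 2) = √π := by
  -- The inverse of `u ↦ u - a / u` on `(0, ∞)`: the positive root of `u² - v u - a = 0`.
  set φ : ℝ → ℝ := fun v => (v + √(v ^ 2 + 4 * a)) / 2 with hφ
  have hpos : ∀ v : ℝ, 0 < v ^ 2 + 4 * a := fun v => by positivity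
  have hsqrt : ∀ v : ℝ, |v| < √(v ^ 2 + 4 * a) := fun v => by
    rw [← Real.sqrt_sq_eq_abs]; exact Real.sqrt_lt_sqrt (sq_nonneg v) (by linarith)
  have hφpos : ∀ v, 0 < φ v := fun v => by
    have := hsqrt v; have := neg_abs_le v; simp only [hφ]; linarith
  have hφinv : ∀ v, φ v - a / φ v = v := fun v => by
    have h := hφpos v
    have hs := Real.sq_sqrt (hpos v).le
    have : φ v * φ v - a = v * φ v := by simp only [hφ]; nlinarith
    field_simp; nlinarith
  have himg : φ '' univ = Ioi 0 := by
    ext u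
    constructor
    · rintro ⟨v, -, rfl⟩; exact hφpos v
    · intro hu
      have hu : 0 < u := hu
      refine ⟨u - a / u, mem_univ _, ?_⟩
      have : (u - a / u) ^ 2 + 4 * a = (u + a / u) ^ 2 := by field_simp; ring
      simp only [hφ]
      rw [this, Real.sqrt_sq (by positivity)]; ring
  have hinj : InjOn φ univ := fun x _ y _ h => by rw [← hφinv x, ← hφinv y, h]
  have hderiv : ∀ v ∈ univ, HasDerivWithinAt φ ((1 + v / √(v ^ 2 + 4 * a)) / 2) univ v := by
    intro v _
    have h1 : HasDerivAt (fun v : ℝ => v ^ 2 + 4 * a) (2 * v) v := by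
      simpa using (hasDerivAt_pow 2 v).add_const (4 * a)
    have h2 := ((hasDerivAt_id v).add (h1.sqrt (hpos v).ne')).div_const 2
    refine (h2.congr_deriv ?_).hasDerivWithinAt
    have := Real.sqrt_pos.2 (hpos v)
    field_simp
  rw [← himg, integral_image_eq_integral_abs_deriv_smul MeasurableSet.univ hderiv hinj]
  simp only [hφinv, Measure.restrict_univ, smul_eq_mul]
  have hle : ∀ v : ℝ, |v / √(v ^ 2 + 4 * a)| ≤ 1 := fun v => by
    rw [abs_div, abs_of_nonneg (Real.sqrt_nonneg _)]
    exact div_le_one_of_le₀ (hsqrt v).le (Real.sqrt_nonneg _)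
  have heq : ∀ v : ℝ, |(1 + v / √(v ^ 2 + 4 * a)) / 2| * (2 * rexp (-v ^ 2)) =
      rexp (-v ^ 2) + v / √(v ^ 2 + 4 * a) * rexp (-v ^ 2) := fun v => by
    rw [abs_of_nonneg (by linarith [(abs_le.1 (hle v)).1])]; ring
  simp only [heq]
  have hg : Integrable (fun v : ℝ => rexp (-v ^ 2)) := by
    simpa using integrable_exp_neg_mul_sq one_pos
  have hcont : Continuous (fun v : ℝ => v / √(v ^ 2 + 4 * a)) :=
    continuous_id.div (by fun_prop) fun v => (Real.sqrt_pos.2 (hpos v)).ne'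
  -- The Jacobian is one half plus an odd function of `v`, and the odd part integrates to zero
  -- against the Gaussian.
  have hodd : ∫ v : ℝ, v / √(v ^ 2 + 4 * a) * rexp (-v ^ 2) = 0 := by
    have := integral_neg_eq_self (fun v : ℝ => v / √(v ^ 2 + 4 * a) * rexp (-v ^ 2)) volume
    simp only [neg_sq, neg_div, neg_mul, integral_neg] at this
    linarith
  rw [integral_add hg (hg.bdd_mul hcont.aestronglyMeasurable (.of_forall hle)), hodd, add_zero]
  simpa using integral_gaussian 1

open Real Set in
/-- The subordination formula for `exp (-2a)`. -/
theorem integral_exp_neg_sq_sub_sq_div_sq {a : ℝ} (ha : 0 ≤ a) :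
    ∫ u in Ioi (0 : ℝ), rexp (-u ^ 2) * rexp (-(a ^ 2 / u ^ 2)) = √π / 2 * rexp (-(2 * a)) := by
  rcases ha.eq_or_lt with rfl | ha
  · simpa using integral_gaussian_Ioi 1
  -- Completing the square: `u² + a²/u² = (u - a/u)² + 2a`.
  · have : ∀ u ∈ Ioi (0 : ℝ), rexp (-u ^ 2) * rexp (-(a ^ 2 / u ^ 2)) =
        (rexp (-(2 * a)) / 2) * (2 * rexp (-(u - a / u) ^ 2)) := by
      intro u hu
      have hu : 0 < u := hu
      rw [← Real.exp_add, div_mul_eq_mul_div, mul_div_assoc, mul_div_cancel_left₀ _ two_ne_zero,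
        ← Real.exp_add]
      congr 1; field_simp; ring
    rw [setIntegral_congr_fun measurableSet_Ioi this, integral_const_mul,
      integral_exp_neg_sub_div_sq ha]
    ring

section Poisson

variable {V : Type*} [NormedAddCommGroup V] [InnerProductSpace ℝ V] [FiniteDimensional ℝ V]
  [MeasurableSpace V] [BorelSpace V]

open Real Set in
theorem integral_gaussian_div_sq {u : ℝ} (hu : 0 < u) :
    ∫ x : V, rexp (-((π * ‖x‖) ^ 2 / u ^ 2)) =
      u ^ (Module.finrank ℝ V : ℝ) * π ^ (-(Module.finrank ℝ V / 2 : ℝ)) := by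
  have := GaussianFourier.integral_rexp_neg_mul_sq_norm (V := V) (b := π ^ 2 / u ^ 2)
    (by positivity)
  have h2 : π / (π ^ 2 / u ^ 2) = u ^ 2 / π := by field_simp
  rw [h2, Real.div_rpow (by positivity) pi_pos.le, ← Real.rpow_ofNat u 2, ← Real.rpow_mul hu.le,
    mul_div_cancel₀ _ two_ne_zero] at this
  rw [Real.rpow_neg pi_pos.le, ← div_eq_mul_inv, ← this]
  congr 1; ext x; congr 1; rw [Real.rpow_ofNat]; ring

open Real Set in
theorem fourier_gaussian_div_sq {u : ℝ} (hu : 0 < u) (ξ : V) :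
    𝓕 (fun x : V => (rexp (-((π * ‖x‖) ^ 2 / u ^ 2)) : ℂ)) ξ =
      ((u ^ (Module.finrank ℝ V : ℝ) * π ^ (-(Module.finrank ℝ V / 2 : ℝ)) *
        rexp (-(‖ξ‖ ^ 2 * u ^ 2)) : ℝ) : ℂ) := by
  have hb : (0 : ℝ) < π ^ 2 / u ^ 2 := by positivity
  have := fourier_gaussian_innerProductSpace (V := V) (b := ((π ^ 2 / u ^ 2 : ℝ) : ℂ))
    (by rwa [Complex.ofReal_re]) ξ
  have h2 : (π : ℂ) / ((π ^ 2 / u ^ 2 : ℝ) : ℂ) = ((u ^ 2 / π : ℝ) : ℂ) := by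
    rw [← Complex.ofReal_div]; congr 1; field_simp
  have h3 : ((u ^ 2 / π : ℝ) : ℂ) ^ (Module.finrank ℝ V / 2 : ℂ) =
      ((u ^ (Module.finrank ℝ V : ℝ) * π ^ (-(Module.finrank ℝ V / 2 : ℝ)) : ℝ) : ℂ) := by
    rw [show (Module.finrank ℝ V / 2 : ℂ) = ((Module.finrank ℝ V / 2 : ℝ) : ℂ) by push_cast; rfl,
      ← Complex.ofReal_cpow (by positivity), Real.div_rpow (by positivity) pi_pos.le,
      ← Real.rpow_ofNat u 2, ← Real.rpow_mul hu.le, mul_div_cancel₀ _ two_ne_zero,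
      Real.rpow_neg pi_pos.le, div_eq_mul_inv]
  rw [h2, h3] at this
  rw [Complex.ofReal_mul, Complex.ofReal_exp]
  convert this using 2
  · ext x; rw [Complex.ofReal_exp]; congr 1; push_cast; ring
  · congr 1; push_cast; have : (π : ℂ) ≠ 0 := by exact_mod_cast pi_ne_zero
    have : (u : ℂ) ≠ 0 := by exact_mod_cast hu.ne'
    field_simp

-- Licenses Fubini in the subordination formula: integrating out `x` leaves a multiple of `u^n
-- e^{-u²}`.
open Real Set in
theorem integrable_prod_exp_neg_sq :
    Integrable (fun p : V × ℝ => rexp (-p.2 ^ 2) * rexp (-((π * ‖p.1‖) ^ 2 / p.2 ^ 2)))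
      ((volume : Measure V).prod (volume.restrict (Ioi (0 : ℝ)))) := by
  have hm : Measurable
      (fun p : V × ℝ => rexp (-p.2 ^ 2) * rexp (-((π * ‖p.1‖) ^ 2 / p.2 ^ 2))) := by fun_prop
  rw [integrable_prod_iff' hm.aestronglyMeasurable]
  constructor
  · filter_upwards [ae_restrict_mem measurableSet_Ioi] with u hu
    have hu : (0 : ℝ) < u := hu
    refine Integrable.const_mul ?_ _
    -- A non-integrable function has integral 0 by convention, whereas this Gaussian integral is
    -- positive.
    by_contra h
    have h1 := integral_gaussian_div_sq (V := V) hu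
    rw [integral_undef h] at h1
    exact absurd h1 (by positivity)
  · have h2 : IntegrableOn (fun u : ℝ => (u ^ (Module.finrank ℝ V : ℝ) * rexp (-1 * u ^ 2)) *
        π ^ (-(Module.finrank ℝ V / 2 : ℝ))) (Ioi 0) :=
      (integrableOn_rpow_mul_exp_neg_mul_sq one_pos
        (by have : (0 : ℝ) ≤ Module.finrank ℝ V := by positivity
            linarith)).mul_const _
    refine h2.congr ?_
    filter_upwards [ae_restrict_mem measurableSet_Ioi] with u hu
    simp only [norm_of_nonneg (mul_pos (exp_pos _) (exp_pos _)).le]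
    rw [integral_const_mul, integral_gaussian_div_sq hu]
    ring_nf

open Real Set in
theorem integrable_exp_neg_norm : Integrable (fun x : V => rexp (-(2 * π * ‖x‖))) := by
  have h := (integrable_prod_exp_neg_sq (V := V)).integral_prod_left
  refine (h.const_mul (√π / 2)⁻¹).congr (.of_forall fun x => ?_)
  simp only
  rw [integral_exp_neg_sq_sub_sq_div_sq (by positivity)]
  have : √π ≠ 0 := (Real.sqrt_pos.2 pi_pos).ne'
  field_simp

/-- The constant in the Fourier transform of `exp (-2π‖x‖)`. -/
noncomputable def poissonConst (n : ℕ) : ℝ :=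
  Real.pi ^ (-((n : ℝ) + 1) / 2) * Real.Gamma (((n : ℝ) + 1) / 2)

theorem poissonConst_pos (n : ℕ) : 0 < poissonConst n :=
  mul_pos (Real.rpow_pos_of_pos Real.pi_pos _) (Real.Gamma_pos_of_pos (by positivity))

-- Subordination makes the function a mixture of Gaussians. After transforming each one, the
-- remaining integral of `u^n e^{-(1+‖ξ‖²)u²}` is a Gamma integral, which produces the exponent
-- `-(n+1)/2`.
open Real Set in
theorem fourier_exp_neg_norm (ξ : V) :
    𝓕 (fun x : V => (rexp (-(2 * π * ‖x‖)) : ℂ)) ξ =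
      ((poissonConst (Module.finrank ℝ V) *
        (1 + ‖ξ‖ ^ 2) ^ (-((Module.finrank ℝ V : ℝ) + 1) / 2) : ℝ) : ℂ) := by
  set n := Module.finrank ℝ V with hn
  have hc : √π ≠ 0 := (Real.sqrt_pos.2 pi_pos).ne'
  have h1 : ∀ x : V, (rexp (-(2 * π * ‖x‖)) : ℂ) = ((√π / 2)⁻¹ : ℝ) *
      ∫ u in Ioi (0 : ℝ), ((rexp (-u ^ 2) * rexp (-((π * ‖x‖) ^ 2 / u ^ 2)) : ℝ) : ℂ) := by
    intro x
    rw [integral_complex_ofReal, integral_exp_neg_sq_sub_sq_div_sq (by positivity),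
      ← Complex.ofReal_mul]
    congr 1; field_simp
  have hint : Integrable (fun p : V × ℝ => Complex.exp ((-2 * π * inner ℝ p.1 ξ : ℝ) * Complex.I) •
      ((rexp (-p.2 ^ 2) * rexp (-((π * ‖p.1‖) ^ 2 / p.2 ^ 2)) : ℝ) : ℂ))
      ((volume : Measure V).prod (volume.restrict (Ioi (0 : ℝ)))) := by
    refine Integrable.bdd_mul (c := 1) integrable_prod_exp_neg_sq.ofReal ?_ (.of_forall fun p => ?_)
    · exact Continuous.aestronglyMeasurable (by fun_prop)
    · rw [Complex.norm_exp_ofReal_mul_I]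
  rw [Real.fourier_eq']
  simp only [h1]
  have h2 : ∀ x : V, Complex.exp ((-2 * π * inner ℝ x ξ : ℝ) * Complex.I) •
      (((√π / 2)⁻¹ : ℝ) *
      ∫ u in Ioi (0 : ℝ), ((rexp (-u ^ 2) * rexp (-((π * ‖x‖) ^ 2 / u ^ 2)) : ℝ) : ℂ)) =
      ((√π / 2)⁻¹ : ℝ) * ∫ u in Ioi (0 : ℝ), Complex.exp ((-2 * π * inner ℝ x ξ : ℝ) * Complex.I) •
        ((rexp (-u ^ 2) * rexp (-((π * ‖x‖) ^ 2 / u ^ 2)) : ℝ) : ℂ) := by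
    intro x; rw [integral_smul, smul_eq_mul, smul_eq_mul]; ring
  simp only [h2]
  rw [integral_const_mul, integral_integral_swap hint]
  have h3 : ∀ u ∈ Ioi (0 : ℝ), ∫ x : V, Complex.exp ((-2 * π * inner ℝ x ξ : ℝ) * Complex.I) •
      ((rexp (-u ^ 2) * rexp (-((π * ‖x‖) ^ 2 / u ^ 2)) : ℝ) : ℂ) =
      ((π ^ (-(n / 2 : ℝ)) * (u ^ (n : ℝ) * rexp (-(1 + ‖ξ‖ ^ 2) * u ^ (2 : ℝ))) : ℝ) : ℂ) := by
    intro u hu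
    have h4 := fourier_gaussian_div_sq (V := V) hu ξ
    rw [Real.fourier_eq'] at h4
    have h5 : ∀ x : V, Complex.exp ((-2 * π * inner ℝ x ξ : ℝ) * Complex.I) •
      ((rexp (-u ^ 2) * rexp (-((π * ‖x‖) ^ 2 / u ^ 2)) : ℝ) : ℂ) = (rexp (-u ^ 2) : ℂ) *
      (Complex.exp ((-2 * π * inner ℝ x ξ : ℝ) * Complex.I) •
      (rexp (-((π * ‖x‖) ^ 2 / u ^ 2)) : ℂ)) := by
      intro x; rw [smul_eq_mul, smul_eq_mul, Complex.ofReal_mul (rexp _)]; ring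
    simp only [h5]
    rw [integral_const_mul, h4, ← Complex.ofReal_mul]
    congr 1
    rw [show -(1 + ‖ξ‖ ^ 2) * u ^ (2 : ℝ) = -u ^ 2 + -(‖ξ‖ ^ 2 * u ^ 2) by
      rw [Real.rpow_ofNat]; ring, Real.exp_add]
    ring
  rw [setIntegral_congr_fun measurableSet_Ioi h3, integral_complex_ofReal, integral_const_mul,
    integral_rpow_mul_exp_neg_mul_rpow two_pos (by linarith [show (0 : ℝ) ≤ n from by positivity])
      (by positivity), ← Complex.ofReal_mul]
  congr 1
  have h6 : π ^ (-((n : ℝ) + 1) / 2) = π ^ (-(n / 2 : ℝ)) * (√π)⁻¹ := by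
    rw [Real.sqrt_eq_rpow, ← Real.rpow_neg pi_pos.le, ← Real.rpow_add pi_pos]; congr 1; ring
  rw [poissonConst, h6]
  field_simp

end Poisson

/-! ### The kernel: band limit, positivity and Harnack inequality -/

/-- The self-convolution `w * w` of a profile. -/
noncomputable def selfConv {d : ℕ} (w : EuclideanSpace ℝ (Fin d) → ℝ) :
    EuclideanSpace ℝ (Fin d) → ℝ :=
  w ⋆[ContinuousLinearMap.mul ℝ ℝ, volume] w

theorem selfConv_apply {d : ℕ} (w : EuclideanSpace ℝ (Fin d) → ℝ) (ξ : EuclideanSpace ℝ (Fin d)) :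
    selfConv w ξ = ∫ t, w t * w (ξ - t) := rfl

theorem kernelHat_apply {d : ℕ} (w : EuclideanSpace ℝ (Fin d) → ℝ)
    (ξ : EuclideanSpace ℝ (Fin d)) :
    kernelHat w ξ = (1 + ‖ξ‖ ^ 2) ^ (-((d : ℝ) + 1) / 2) * selfConv w ξ := rfl

/-- The Fourier transform of a profile, which is real because profiles are even. -/
noncomputable def profileHat {d : ℕ} (w : EuclideanSpace ℝ (Fin d) → ℝ)
    (ξ : EuclideanSpace ℝ (Fin d)) : ℝ :=
  (𝓕 (fun x => (w x : ℂ)) ξ).re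

theorem conj_fourier_ofReal {V : Type*} [NormedAddCommGroup V] [InnerProductSpace ℝ V]
    [FiniteDimensional ℝ V] [MeasurableSpace V] [BorelSpace V] {f : V → ℝ}
    (hf : ∀ x, f (-x) = f x) (ξ : V) :
    (starRingEnd ℂ) (𝓕 (fun x => (f x : ℂ)) ξ) = 𝓕 (fun x => (f x : ℂ)) ξ := by
  rw [Real.fourier_eq', ← integral_conj, ← integral_neg_eq_self]
  congr 1; ext x
  simp only [smul_eq_mul, map_mul, Complex.conj_ofReal, hf, inner_neg_left, ← Complex.exp_conj,
    Complex.conj_I]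
  congr 2
  push_cast; ring

theorem fourierInv_ofReal_eq_fourier {V : Type*} [NormedAddCommGroup V] [InnerProductSpace ℝ V]
    [FiniteDimensional ℝ V] [MeasurableSpace V] [BorelSpace V] {f : V → ℝ}
    (hf : ∀ x, f (-x) = f x) (ξ : V) :
    𝓕⁻ (fun x => (f x : ℂ)) ξ = 𝓕 (fun x => (f x : ℂ)) ξ := by
  rw [Real.fourierInv_eq', Real.fourier_eq', ← integral_neg_eq_self]
  congr 1; ext x
  simp only [smul_eq_mul, hf, inner_neg_left]
  congr 2
  push_cast; ring

namespace IsProfile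

variable {d : ℕ} {w : EuclideanSpace ℝ (Fin d) → ℝ} (hw : IsProfile w)
include hw

theorem even (ξ : EuclideanSpace ℝ (Fin d)) : w (-ξ) = w ξ := hw.radial _ _ (norm_neg ξ)

theorem hasCompactSupport : HasCompactSupport w :=
  HasCompactSupport.intro (isCompact_closedBall (0 : EuclideanSpace ℝ (Fin d)) (1 / 2))
    fun ξ hξ => hw.eq_zero ξ (by
      rw [Metric.mem_closedBall, dist_zero_right, not_le] at hξ; exact hξ.le)

theorem continuous : Continuous w := hw.smooth.continuous

theorem integrable : Integrable w := hw.continuous.integrable_of_hasCompactSupport hw.hasCompactSupport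

theorem integrable_sq : Integrable (fun ξ => w ξ ^ 2) := by
  refine (hw.continuous.pow 2).integrable_of_hasCompactSupport ?_
  refine HasCompactSupport.intro (isCompact_closedBall (0 : EuclideanSpace ℝ (Fin d)) (1 / 2))
    fun ξ hξ => ?_
  rw [Metric.mem_closedBall, dist_zero_right, not_le] at hξ
  rw [Pi.pow_apply, hw.eq_zero ξ hξ.le, zero_pow two_ne_zero]

theorem selfConv_contDiff : ContDiff ℝ ((⊤ : ℕ∞) : WithTop ℕ∞) (selfConv w) :=
  hw.hasCompactSupport.contDiff_convolution_right _ hw.continuous.locallyIntegrable hw.smooth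

/-- If `‖ξ‖ ≥ 1`, then `t` and `ξ - t` cannot both have norm below `1/2`. This is the source of the
band limit. -/
theorem selfConv_eq_zero {ξ : EuclideanSpace ℝ (Fin d)} (hξ : 1 ≤ ‖ξ‖) : selfConv w ξ = 0 := by
  rw [selfConv_apply, ← integral_zero (EuclideanSpace ℝ (Fin d)) ℝ]
  congr 1; ext t
  by_cases ht : 1 / 2 ≤ ‖t‖
  · rw [hw.eq_zero t ht, zero_mul]
  · rw [hw.eq_zero (ξ - t), mul_zero]
    have := norm_sub_norm_le ξ t
    linarith [not_le.1 ht]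

theorem selfConv_zero : selfConv w 0 = 1 := by
  rw [selfConv_apply, ← hw.integral_sq]
  congr 1; ext t; rw [zero_sub, hw.even, sq]

/-- Uses `|ab| ≤ (a² + b²)/2` and translation invariance in place of Cauchy–Schwarz. -/
theorem abs_selfConv_le_one (ξ : EuclideanSpace ℝ (Fin d)) : |selfConv w ξ| ≤ 1 := by
  have h2 : Integrable (fun t => w (ξ - t) ^ 2) := hw.integrable_sq.comp_sub_left ξ
  have h3 : ∫ t, w (ξ - t) ^ 2 = 1 := by
    rw [integral_sub_left_eq_self (fun t => w t ^ 2) volume ξ, hw.integral_sq]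
  rw [selfConv_apply, ← Real.norm_eq_abs]
  calc ‖∫ t, w t * w (ξ - t)‖ ≤ ∫ t, (w t ^ 2 + w (ξ - t) ^ 2) / 2 := by
        refine norm_integral_le_of_norm_le ((hw.integrable_sq.add h2).div_const 2)
          (.of_forall fun t => ?_)
        rw [Real.norm_eq_abs, abs_le]
        constructor <;> nlinarith [sq_nonneg (w t - w (ξ - t)), sq_nonneg (w t + w (ξ - t))]
    _ = 1 := by
        rw [integral_div, integral_add hw.integrable_sq h2, h3, hw.integral_sq]; norm_num

theorem selfConv_comp_linearIsometryEquiv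
    (A : EuclideanSpace ℝ (Fin d) ≃ₗᵢ[ℝ] EuclideanSpace ℝ (Fin d)) (ξ : EuclideanSpace ℝ (Fin d)) :
    selfConv w (A ξ) = selfConv w ξ := by
  rw [selfConv_apply, selfConv_apply,
    ← A.measurePreserving.integral_comp A.toHomeomorph.measurableEmbedding]
  congr 1; ext t
  rw [← map_sub, hw.radial (A t) t (A.norm_map t), hw.radial (A (ξ - t)) _ (A.norm_map _)]

theorem kernelHat_comp_linearIsometryEquiv
    (A : EuclideanSpace ℝ (Fin d) ≃ₗᵢ[ℝ] EuclideanSpace ℝ (Fin d)) (ξ : EuclideanSpace ℝ (Fin d)) :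
    kernelHat w (A ξ) = kernelHat w ξ := by
  rw [kernelHat_apply, kernelHat_apply, hw.selfConv_comp_linearIsometryEquiv, A.norm_map]

theorem kernelHat_neg (ξ : EuclideanSpace ℝ (Fin d)) : kernelHat w (-ξ) = kernelHat w ξ :=
  hw.kernelHat_comp_linearIsometryEquiv (LinearIsometryEquiv.neg ℝ) ξ

theorem kernelHat_eq_zero {ξ : EuclideanSpace ℝ (Fin d)} (hξ : 1 ≤ ‖ξ‖) : kernelHat w ξ = 0 := by
  rw [kernelHat_apply, hw.selfConv_eq_zero hξ, mul_zero]

theorem kernelHat_zero : kernelHat w 0 = 1 := by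
  rw [kernelHat_apply, hw.selfConv_zero]; simp

theorem abs_kernelHat_le_one (ξ : EuclideanSpace ℝ (Fin d)) : |kernelHat w ξ| ≤ 1 := by
  have h0 : (0 : ℝ) ≤ (1 + ‖ξ‖ ^ 2) ^ (-((d : ℝ) + 1) / 2) := by positivity
  rw [kernelHat_apply, abs_mul, abs_of_nonneg h0]
  refine mul_le_one₀ (Real.rpow_le_one_of_one_le_of_nonpos ?_ ?_) (abs_nonneg _)
    (hw.abs_selfConv_le_one ξ)
  · nlinarith [norm_nonneg ξ]
  · have : (0 : ℝ) ≤ d := by positivity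
    linarith

theorem kernelHat_contDiff : ContDiff ℝ ((⊤ : ℕ∞) : WithTop ℕ∞) (kernelHat w) := by
  refine ContDiff.mul (ContDiff.rpow_const_of_ne (contDiff_const.add (contDiff_norm_sq ℝ))
    fun ξ => ?_) hw.selfConv_contDiff
  positivity

theorem kernelHat_hasCompactSupport : HasCompactSupport (kernelHat w) :=
  HasCompactSupport.intro (isCompact_closedBall (0 : EuclideanSpace ℝ (Fin d)) 1)
    fun ξ hξ => hw.kernelHat_eq_zero (by
      rw [Metric.mem_closedBall, dist_zero_right, not_le] at hξ; exact hξ.le)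

/-- `kernelHat w` as a complex Schwartz function. -/
noncomputable def kernelHatSchwartz : SchwartzMap (EuclideanSpace ℝ (Fin d)) ℂ :=
  (hw.kernelHat_hasCompactSupport.comp_left (g := ((↑) : ℝ → ℂ)) rfl).toSchwartzMap
    (Complex.ofRealCLM.contDiff.comp hw.kernelHat_contDiff)

/-- A profile as a complex Schwartz function. -/
noncomputable def toSchwartz : SchwartzMap (EuclideanSpace ℝ (Fin d)) ℂ :=
  (hw.hasCompactSupport.comp_left (g := ((↑) : ℝ → ℂ)) rfl).toSchwartzMap
    (Complex.ofRealCLM.contDiff.comp hw.smooth)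

theorem coe_kernelHatSchwartz : (hw.kernelHatSchwartz : EuclideanSpace ℝ (Fin d) → ℂ) =
    fun ξ => (kernelHat w ξ : ℂ) := rfl

theorem coe_toSchwartz : (hw.toSchwartz : EuclideanSpace ℝ (Fin d) → ℂ) =
    fun ξ => (w ξ : ℂ) := rfl

theorem ofReal_profileHat (ξ : EuclideanSpace ℝ (Fin d)) :
    (profileHat w ξ : ℂ) = 𝓕 (fun x => (w x : ℂ)) ξ :=
  Complex.conj_eq_iff_re.1 (conj_fourier_ofReal hw.even ξ)

theorem ofReal_kernel (x : EuclideanSpace ℝ (Fin d)) :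
    (kernel w x : ℂ) = 𝓕⁻ (fun ξ => (kernelHat w ξ : ℂ)) x := by
  have := conj_fourier_ofReal hw.kernelHat_neg x
  rw [← fourierInv_ofReal_eq_fourier hw.kernelHat_neg] at this
  exact Complex.conj_eq_iff_re.1 this

theorem ofReal_kernel_eq_schwartz (x : EuclideanSpace ℝ (Fin d)) :
    (kernel w x : ℂ) = (𝓕⁻ hw.kernelHatSchwartz) x := by
  rw [hw.ofReal_kernel, SchwartzMap.fourierInv_coe, hw.coe_kernelHatSchwartz]

theorem kernel_eq_re (x : EuclideanSpace ℝ (Fin d)) :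
    kernel w x = ((𝓕⁻ hw.kernelHatSchwartz) x).re := by
  rw [← hw.ofReal_kernel_eq_schwartz, Complex.ofReal_re]

theorem norm_kernel (x : EuclideanSpace ℝ (Fin d)) :
    ‖kernel w x‖ = ‖(𝓕⁻ hw.kernelHatSchwartz) x‖ := by
  rw [← hw.ofReal_kernel_eq_schwartz, Complex.norm_real]

theorem kernel_continuous : Continuous (kernel w) := by
  have := Complex.continuous_re.comp (𝓕⁻ hw.kernelHatSchwartz).continuous
  exact this.congr fun x => (hw.kernel_eq_re x).symm

theorem kernel_integrable : Integrable (kernel w) := by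
  refine (𝓕⁻ hw.kernelHatSchwartz).integrable.re.congr (.of_forall fun x => ?_)
  exact (hw.kernel_eq_re x).symm

theorem fourier_kernel (ξ : EuclideanSpace ℝ (Fin d)) :
    𝓕 (fun x => (kernel w x : ℂ)) ξ = kernelHat w ξ := by
  have h : (fun x => (kernel w x : ℂ)) = ⇑(𝓕⁻ hw.kernelHatSchwartz : SchwartzMap (EuclideanSpace ℝ (Fin d)) ℂ) :=
    funext hw.ofReal_kernel_eq_schwartz
  rw [h, ← SchwartzMap.fourier_coe, FourierTransform.fourier_fourierInv_eq]
  rfl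

theorem integral_kernel : ∫ x, kernel w x = 1 := by
  have h := hw.fourier_kernel 0
  rw [Real.fourier_eq', hw.kernelHat_zero] at h
  simp only [inner_zero_right, mul_zero, Complex.ofReal_zero, zero_mul, Complex.exp_zero,
    one_smul, integral_complex_ofReal] at h
  exact_mod_cast h

/-- The reflection in the hyperplane orthogonal to `x - y` carries `x` to `y` and preserves
`kernelHat w`. -/
theorem kernel_radial {x y : EuclideanSpace ℝ (Fin d)} (h : ‖x‖ = ‖y‖) :
    kernel w x = kernel w y := by
  set A := (Submodule.span ℝ {x - y})ᗮ.reflection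
  have hA : A x = y := Submodule.reflection_sub h
  have h1 := Real.fourierInv_comp_linearIsometry A (fun ξ => (kernelHat w ξ : ℂ)) x
  have h2 : (fun ξ => (kernelHat w ξ : ℂ)) ∘ A = fun ξ => (kernelHat w ξ : ℂ) := by
    ext ξ; simp [hw.kernelHat_comp_linearIsometryEquiv]
  rw [h2, hA] at h1
  rw [kernel, kernel, h1]

theorem fourier_selfConv (ξ : EuclideanSpace ℝ (Fin d)) :
    𝓕 (fun x => (selfConv w x : ℂ)) ξ = ((profileHat w ξ ^ 2 : ℝ) : ℂ) := by
  have h := Real.fourier_mul_convolution_eq (f₁ := fun x => (w x : ℂ)) (f₂ := fun x => (w x : ℂ))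
    hw.integrable.ofReal hw.integrable.ofReal ξ
  rw [← hw.ofReal_profileHat, ← Complex.ofReal_mul, ← sq] at h
  rw [← h]
  refine congrArg (fun F : EuclideanSpace ℝ (Fin d) → ℂ => 𝓕 F ξ) (funext fun x => ?_)
  rw [selfConv_apply, convolution_def, ← integral_complex_ofReal]
  simp

theorem profileHat_continuous : Continuous (profileHat w) :=
  Complex.continuous_re.comp (𝓕 hw.toSchwartz).continuous

/-- Fourier inversion would otherwise force `w = 0`, against `∫ w² = 1`. This is what makes the
positivity of the kernel strict. -/
theorem exists_profileHat_ne_zero : ∃ ξ, profileHat w ξ ≠ 0 := by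
  by_contra! h
  have h1 : 𝓕 hw.toSchwartz = 0 := by
    ext ξ
    rw [SchwartzMap.fourier_coe, hw.coe_toSchwartz, ← hw.ofReal_profileHat, h ξ]; rfl
  have h2 : hw.toSchwartz = 0 := by
    rw [← FourierTransform.fourierInv_fourier_eq (F := SchwartzMap (EuclideanSpace ℝ (Fin d)) ℂ)
      hw.toSchwartz, h1, FourierTransform.fourierInv_zero]
  have h3 : ∀ ξ, w ξ = 0 := fun ξ => by
    have : hw.toSchwartz ξ = 0 := by rw [h2]; rfl
    exact Complex.ofReal_eq_zero.1 this
  have := hw.integral_sq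
  simp [h3] at this

theorem integrable_exp_mul_profileHat (x : EuclideanSpace ℝ (Fin d)) :
    Integrable (fun y => Real.exp (-(2 * Real.pi * ‖y + x‖)) * profileHat w y ^ 2) := by
  have hG := (integrable_exp_neg_norm (V := EuclideanSpace ℝ (Fin d))).comp_add_right x
  refine hG.mul_bdd (c := (∫ y, ‖(w y : ℂ)‖) ^ 2)
    (hw.profileHat_continuous.pow 2).aestronglyMeasurable (.of_forall fun y => ?_)
  rw [norm_pow]
  gcongr
  rw [← Complex.norm_real, hw.ofReal_profileHat]
  exact VectorFourier.norm_fourierIntegral_le_integral_norm _ _ _ _ _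

/-- The kernel is the convolution of a Poisson-type kernel with the square of `profileHat w`. -/
theorem kernel_eq_integral (x : EuclideanSpace ℝ (Fin d)) :
    kernel w x = (poissonConst d)⁻¹ *
      ∫ y, Real.exp (-(2 * Real.pi * ‖y + x‖)) * profileHat w y ^ 2 := by
  -- Modulating by `x` in frequency translates the transform, so `𝓕 g` is `profileHat w ^ 2` shifted
  -- by `x`.
  set g : EuclideanSpace ℝ (Fin d) → ℂ := fun ξ =>
    Complex.exp ((2 * Real.pi * inner ℝ ξ x : ℝ) * Complex.I) * (selfConv w ξ : ℂ) with hg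
  have hgint : Integrable g := by
    have h1 : HasCompactSupport (selfConv w) :=
      HasCompactSupport.intro (isCompact_closedBall (0 : EuclideanSpace ℝ (Fin d)) 1)
        fun ξ hξ => hw.selfConv_eq_zero (by
          rw [Metric.mem_closedBall, dist_zero_right, not_le] at hξ; exact hξ.le)
    have h2 := hw.selfConv_contDiff.continuous
    refine Continuous.integrable_of_hasCompactSupport (by fun_prop) ?_
    exact (h1.comp_left (g := ((↑) : ℝ → ℂ)) rfl).mul_left
  have hFg : ∀ y, 𝓕 g y = ((profileHat w (y - x) ^ 2 : ℝ) : ℂ) := by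
    intro y
    rw [← hw.fourier_selfConv, Real.fourier_eq', Real.fourier_eq']
    congr 1; ext ξ
    simp only [hg, smul_eq_mul]
    rw [← mul_assoc, ← Complex.exp_add, inner_sub_right]
    congr 2
    push_cast; ring
  have hG : Integrable (fun y : EuclideanSpace ℝ (Fin d) =>
      (Real.exp (-(2 * Real.pi * ‖y‖)) : ℂ)) := integrable_exp_neg_norm.ofReal
  -- The multiplication formula `∫ f̂ g = ∫ f ĝ`, with `f` the exponential.
  have hflip := VectorFourier.integral_fourierIntegral_smul_eq_flip
    (L := innerₗ (EuclideanSpace ℝ (Fin d))) Real.continuous_fourierChar continuous_inner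
    hG hgint
  rw [flip_innerₗ] at hflip
  change ∫ ξ, (𝓕 (fun y : EuclideanSpace ℝ (Fin d) =>
    (Real.exp (-(2 * Real.pi * ‖y‖)) : ℂ)) ξ) • g ξ =
    ∫ y, (Real.exp (-(2 * Real.pi * ‖y‖)) : ℂ) • 𝓕 g y at hflip
  have hC : (poissonConst d : ℂ) ≠ 0 := Complex.ofReal_ne_zero.2 (poissonConst_pos d).ne'
  have h3 : (kernel w x : ℂ) = (poissonConst d : ℂ)⁻¹ *
      ∫ y, (Real.exp (-(2 * Real.pi * ‖y‖)) : ℂ) • 𝓕 g y := by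
    rw [← hflip, hw.ofReal_kernel, Real.fourierInv_eq', ← integral_const_mul]
    congr 1; ext ξ
    rw [fourier_exp_neg_norm, kernelHat_apply, finrank_euclideanSpace_fin]
    simp only [hg, smul_eq_mul, Complex.ofReal_mul]
    field_simp
  simp only [hFg, smul_eq_mul, ← Complex.ofReal_mul] at h3
  rw [integral_complex_ofReal, ← Complex.ofReal_inv, ← Complex.ofReal_mul,
    Complex.ofReal_inj] at h3
  rw [h3, ← integral_add_right_eq_self _ x]
  simp only [add_sub_cancel_right]

theorem kernel_pos (x : EuclideanSpace ℝ (Fin d)) : 0 < kernel w x := by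
  rw [hw.kernel_eq_integral]
  refine mul_pos (inv_pos.2 (poissonConst_pos d)) ?_
  have hc : Continuous
      (fun y => Real.exp (-(2 * Real.pi * ‖y + x‖)) * profileHat w y ^ 2) := by
    have := hw.profileHat_continuous
    fun_prop
  rw [integral_pos_iff_support_of_nonneg (fun y => by positivity)
    (hw.integrable_exp_mul_profileHat x)]
  refine hc.isOpen_support.measure_pos _ ?_
  obtain ⟨ξ, hξ⟩ := hw.exists_profileHat_ne_zero
  exact ⟨ξ, mul_ne_zero (Real.exp_pos _).ne' (pow_ne_zero 2 hξ)⟩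

/-- The Harnack inequality for the kernel. -/
theorem exp_mul_kernel_le (x e : EuclideanSpace ℝ (Fin d)) :
    Real.exp (-(2 * Real.pi * ‖e‖)) * kernel w x ≤ kernel w (x + e) := by
  rw [hw.kernel_eq_integral, hw.kernel_eq_integral, mul_left_comm, ← integral_const_mul]
  refine mul_le_mul_of_nonneg_left ?_ (inv_pos.2 (poissonConst_pos d)).le
  refine integral_mono ((hw.integrable_exp_mul_profileHat x).const_mul _)
    (hw.integrable_exp_mul_profileHat _) fun y => ?_
  simp only
  rw [← mul_assoc, ← Real.exp_add]
  refine mul_le_mul_of_nonneg_right (Real.exp_le_exp.2 ?_) (sq_nonneg _)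
  -- The whole inequality is inherited from the exponential factor by the triangle inequality; the
  -- weight `profileHat w y ^ 2` does not move.
  have := norm_add_le (y + x) e
  rw [← add_assoc]
  nlinarith [Real.pi_pos]

end IsProfile

/-! ### Tail integrals of the kernel and decay of `ψ` -/

namespace IsProfile

variable {d : ℕ} {w : EuclideanSpace ℝ (Fin d) → ℝ} (hw : IsProfile w)
include hw

theorem tail_antitone : Antitone (tail w) := fun _ _ hst =>
  setIntegral_mono_set hw.kernel_integrable.integrableOn
    (.of_forall fun x => (hw.kernel_pos x).le)
    (LE.le.eventuallyLE fun _ hx => le_trans hst hx)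

theorem tail_nonneg (t : ℝ) : 0 ≤ tail w t := integral_nonneg fun x => (hw.kernel_pos x).le

theorem tail_le_one (t : ℝ) : tail w t ≤ 1 :=
  (setIntegral_le_integral hw.kernel_integrable (.of_forall fun x => (hw.kernel_pos x).le)).trans_eq
    hw.integral_kernel

theorem setIntegral_kernel_pos {s : Set (EuclideanSpace ℝ (Fin d))} (hs : volume s ≠ 0) :
    0 < ∫ x in s, kernel w x := by
  rw [setIntegral_pos_iff_support_of_nonneg_ae (.of_forall fun x => (hw.kernel_pos x).le)
    hw.kernel_integrable.integrableOn]
  rw [Function.support_eq_univ (fun x => (hw.kernel_pos x).ne'), Set.univ_inter]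
  exact pos_iff_ne_zero.2 hs

theorem tail_pos (hd : 1 ≤ d) (t : ℝ) : 0 < tail w t := by
  have : Nonempty (Fin d) := ⟨⟨0, hd⟩⟩
  refine hw.setIntegral_kernel_pos fun h => ?_
  have ho : IsOpen {x : EuclideanSpace ℝ (Fin d) | t < ‖x‖} := isOpen_lt continuous_const continuous_norm
  have hne : {x : EuclideanSpace ℝ (Fin d) | t < ‖x‖}.Nonempty := by
    obtain ⟨x, hx⟩ := NormedSpace.exists_lt_norm ℝ (EuclideanSpace ℝ (Fin d)) t
    exact ⟨x, hx⟩
  exact (ho.measure_pos volume hne).ne' (measure_mono_null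
    (show {x : EuclideanSpace ℝ (Fin d) | t < ‖x‖} ⊆ {x | t ≤ ‖x‖} from fun x (hx : t < ‖x‖) => hx.le) h)

theorem setIntegral_closedBall_pos :
    0 < ∫ y in {y : EuclideanSpace ℝ (Fin d) | ‖y‖ ≤ 1}, kernel w y := by
  refine hw.setIntegral_kernel_pos ?_
  have : {y : EuclideanSpace ℝ (Fin d) | ‖y‖ ≤ 1} = Metric.closedBall 0 1 := by ext; simp
  rw [this]
  exact (Metric.measure_closedBall_pos volume _ one_pos).ne'

theorem gam_pos : 0 < gam w :=
  inv_pos.2 (mul_pos (Real.exp_pos _) hw.setIntegral_closedBall_pos)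

theorem psi_pos (hd : 1 ≤ d) (t : ℝ) : 0 < psi w t :=
  mul_pos (mul_pos four_pos hw.gam_pos) (hw.tail_pos hd _)

theorem integrable_norm_pow_mul_kernel (n : ℕ) :
    Integrable (fun x => ‖x‖ ^ n * kernel w x) := by
  refine ((𝓕⁻ hw.kernelHatSchwartz).integrable_pow_mul volume n).congr (.of_forall fun x => ?_)
  simp only
  rw [← hw.norm_kernel, Real.norm_of_nonneg (hw.kernel_pos x).le]

/-- Markov's inequality for the moments of the kernel, which are finite because the kernel is
Schwartz. -/
theorem pow_mul_tail_le {t : ℝ} (ht : 0 ≤ t) (n : ℕ) :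
    t ^ n * tail w t ≤ ∫ x, ‖x‖ ^ n * kernel w x := by
  rw [tail, ← integral_const_mul]
  calc ∫ x in {x : EuclideanSpace ℝ (Fin d) | t ≤ ‖x‖}, t ^ n * kernel w x
      ≤ ∫ x in {x : EuclideanSpace ℝ (Fin d) | t ≤ ‖x‖}, ‖x‖ ^ n * kernel w x := by
        refine setIntegral_mono_on (hw.kernel_integrable.const_mul _).integrableOn
          (hw.integrable_norm_pow_mul_kernel n).integrableOn
          (measurableSet_le measurable_const measurable_norm) fun x hx => ?_
        exact mul_le_mul_of_nonneg_right (pow_le_pow_left₀ ht hx n) (hw.kernel_pos x).le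
    _ ≤ _ := setIntegral_le_integral (hw.integrable_norm_pow_mul_kernel n)
        (.of_forall fun x => mul_nonneg (by positivity) (hw.kernel_pos x).le)

theorem exists_psi_le (α : ℝ) : ∃ c : ℝ, ∀ t : ℝ, 0 ≤ t → psi w t ≤ c * (1 + t) ^ (-α) := by
  set n := ⌈α⌉₊
  set M := ∫ x, ‖x‖ ^ n * kernel w x
  have hM : 0 ≤ M := integral_nonneg fun x => mul_nonneg (by positivity) (hw.kernel_pos x).le
  -- The two summands serve two ranges: `1 + t ≤ 4 (t/2)` and a moment bound for `t ≥ 1`, and `(1 +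
  -- t)^n ≤ 4^n` with `tail ≤ 1` for `t ≤ 1`.
  refine ⟨4 * gam w * (4 ^ n * M + 4 ^ n), fun t ht => ?_⟩
  have hg := hw.gam_pos
  rw [psi, mul_assoc _ _ ((1 + t) ^ (-α))]
  refine mul_le_mul_of_nonneg_left ?_ (by positivity)
  have h1 : (1 + t) ^ (-(n : ℝ)) ≤ (1 + t) ^ (-α) :=
    Real.rpow_le_rpow_of_exponent_le (by linarith) (neg_le_neg (Nat.le_ceil α))
  refine le_trans ?_ (mul_le_mul_of_nonneg_left h1 (by positivity))
  rw [Real.rpow_neg (by linarith), Real.rpow_natCast, ← div_eq_mul_inv, le_div_iff₀ (by positivity)]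
  have hT := hw.tail_nonneg (t / 2)
  rcases le_total 1 t with h | h
  · have h2 := hw.pow_mul_tail_le (t := t / 2) (by positivity) n
    have h3 : (1 + t) ^ n ≤ 4 ^ n * (t / 2) ^ n := by
      rw [← mul_pow]; exact pow_le_pow_left₀ (by positivity) (by linarith) n
    calc tail w (t / 2) * (1 + t) ^ n ≤ tail w (t / 2) * (4 ^ n * (t / 2) ^ n) := by gcongr
      _ = 4 ^ n * ((t / 2) ^ n * tail w (t / 2)) := by ring
      _ ≤ 4 ^ n * M := by gcongr
      _ ≤ _ := by linarith [show (0 : ℝ) ≤ 4 ^ n by positivity]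
  · have h3 : (1 + t) ^ n ≤ 4 ^ n := pow_le_pow_left₀ (by positivity) (by linarith) n
    calc tail w (t / 2) * (1 + t) ^ n ≤ 1 * 4 ^ n := by
          gcongr; exact hw.tail_le_one _
      _ ≤ _ := by linarith [show (0 : ℝ) ≤ 4 ^ n * M by positivity]

-- Polar coordinates reduce the tail to one dimension, where the radial shift `r ↦ r + 1` is a
-- measure-preserving translation.
open Set in
theorem tail_eq_integral_Ioi (hd : 1 ≤ d) {e : EuclideanSpace ℝ (Fin d)} (he : ‖e‖ = 1)
    {t : ℝ} (ht : 0 ≤ t) :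
    IntegrableOn (fun r : ℝ => r ^ (d - 1) * kernel w (r • e)) (Ioi t) ∧
    tail w t = (d * volume.real (Metric.ball (0 : EuclideanSpace ℝ (Fin d)) 1)) *
      ∫ r in Ioi t, r ^ (d - 1) * kernel w (r • e) := by
  have : Nonempty (Fin d) := ⟨⟨0, hd⟩⟩
  set f : ℝ → ℝ := (Ici t).indicator fun r => kernel w (r • e) with hf
  have hms : MeasurableSet {x : EuclideanSpace ℝ (Fin d) | t ≤ ‖x‖} :=
    measurableSet_le measurable_const measurable_norm
  have hfx : (fun x : EuclideanSpace ℝ (Fin d) => f ‖x‖) =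
      {x : EuclideanSpace ℝ (Fin d) | t ≤ ‖x‖}.indicator (kernel w) := by
    ext x
    by_cases hx : t ≤ ‖x‖
    · rw [hf, indicator_of_mem (show ‖x‖ ∈ Ici t from hx), indicator_of_mem (show x ∈ _ from hx)]
      exact hw.kernel_radial (by rw [norm_smul, norm_norm, he, mul_one])
    · rw [hf, indicator_of_notMem (show ‖x‖ ∉ Ici t from hx),
        indicator_of_notMem (show x ∉ {x | t ≤ ‖x‖} from hx)]
  have hset : (Ioi 0 ∩ Ici t : Set ℝ) =ᵐ[volume] Ioi t := by
    filter_upwards [Ioi_ae_eq_Ici (μ := (volume : Measure ℝ)) (a := t)] with r hr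
    have : r ∈ Ioi t ↔ r ∈ Ici t := iff_of_eq hr
    refine propext ⟨fun h => this.2 h.2, fun h => ⟨lt_of_le_of_lt ht h, this.1 h⟩⟩
  have hmul : ∀ r : ℝ, r ^ (d - 1) • f r =
      (Ici t).indicator (fun r => r ^ (d - 1) * kernel w (r • e)) r := fun r => by
    rw [hf, smul_eq_mul, indicator_mul_right]
  constructor
  · have h1 : Integrable (fun x : EuclideanSpace ℝ (Fin d) => f ‖x‖) := by
      rw [hfx]; exact hw.kernel_integrable.indicator hms
    rw [integrable_fun_norm_addHaar] at h1
    simp only [finrank_euclideanSpace_fin, hmul] at h1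
    rw [IntegrableOn, integrable_indicator_iff measurableSet_Ici, IntegrableOn,
      Measure.restrict_restrict measurableSet_Ici, inter_comm, Measure.restrict_congr_set hset] at h1
    exact h1
  · rw [tail, ← integral_indicator hms, ← hfx, integral_fun_norm_addHaar]
    simp only [finrank_euclideanSpace_fin, hmul]
    rw [setIntegral_indicator measurableSet_Ici, setIntegral_congr_set hset]
    simp [mul_assoc]

/-- The tail integral loses at most a factor `exp (-2π)` under a unit shift. -/
theorem exp_mul_tail_le (hd : 1 ≤ d) {t : ℝ} (ht : 0 ≤ t) :
    Real.exp (-(2 * Real.pi)) * tail w t ≤ tail w (t + 1) := by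
  have : Nonempty (Fin d) := ⟨⟨0, hd⟩⟩
  obtain ⟨e, he⟩ := exists_norm_eq (EuclideanSpace ℝ (Fin d)) zero_le_one
  obtain ⟨hi0, ht0⟩ := hw.tail_eq_integral_Ioi hd he ht
  obtain ⟨hi1, ht1⟩ := hw.tail_eq_integral_Ioi hd he (show 0 ≤ t + 1 by linarith)
  rw [ht0, ht1, mul_left_comm, ← integral_const_mul]
  refine mul_le_mul_of_nonneg_left ?_ (by positivity)
  have hmp := measurePreserving_add_right (volume : Measure ℝ) 1
  have hemb := (MeasurableEquiv.addRight (1 : ℝ)).measurableEmbedding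
  have hpre : (fun r : ℝ => r + 1) ⁻¹' Set.Ioi (t + 1) = Set.Ioi t := by ext; simp
  have hi2 : IntegrableOn (fun r : ℝ => (r + 1) ^ (d - 1) * kernel w ((r + 1) • e)) (Set.Ioi t) := by
    have := (hmp.integrableOn_comp_preimage hemb).2 hi1
    rwa [hpre] at this
  rw [← hmp.setIntegral_preimage_emb hemb _ (Set.Ioi (t + 1)), hpre]
  refine setIntegral_mono_on (hi0.const_mul _) hi2 measurableSet_Ioi fun r hr => ?_
  have hr0 : 0 ≤ r := ht.trans (le_of_lt hr)
  -- Harnack along the ray costs `e^{-2π}`, and the weight `r^(d-1)` only grows under the shift.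
  have h1 := hw.exp_mul_kernel_le (r • e) e
  rw [he, mul_one, show r • e + e = (r + 1) • e by rw [add_smul, one_smul]] at h1
  calc Real.exp (-(2 * Real.pi)) * (r ^ (d - 1) * kernel w (r • e))
      = r ^ (d - 1) * (Real.exp (-(2 * Real.pi)) * kernel w (r • e)) := by ring
    _ ≤ (r + 1) ^ (d - 1) * kernel w ((r + 1) • e) :=
        mul_le_mul (pow_le_pow_left₀ hr0 (by linarith) _) h1
          (mul_nonneg (Real.exp_pos _).le (hw.kernel_pos _).le) (by positivity)

end IsProfile

/-! ### Existence of profiles -/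

/-- Normalized radial bumps are profiles. -/
theorem exists_isProfile (d : ℕ) : ∃ w : EuclideanSpace ℝ (Fin d) → ℝ, IsProfile w := by
  set b : EuclideanSpace ℝ (Fin d) → ℝ := fun ξ => Real.smoothTransition (1 / 4 - ‖ξ‖ ^ 2) with hb
  have hsm : ContDiff ℝ ((⊤ : ℕ∞) : WithTop ℕ∞) b :=
    Real.smoothTransition.contDiff.comp (contDiff_const.sub (contDiff_norm_sq ℝ))
  have h0 : ∀ ξ, 1 / 2 ≤ ‖ξ‖ → b ξ = 0 := fun ξ hξ =>
    Real.smoothTransition.zero_of_nonpos (by nlinarith)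
  have hcs : HasCompactSupport fun ξ => b ξ ^ 2 :=
    HasCompactSupport.intro (isCompact_closedBall (0 : EuclideanSpace ℝ (Fin d)) (1 / 2))
      fun ξ hξ => by
        rw [Metric.mem_closedBall, dist_zero_right, not_le] at hξ
        rw [h0 ξ hξ.le, zero_pow two_ne_zero]
  have hpos : 0 < ∫ ξ, b ξ ^ 2 := by
    refine (hsm.continuous.pow 2).integral_pos_of_hasCompactSupport_nonneg_nonzero hcs
      (fun ξ => sq_nonneg _) (x := 0) ?_
    exact pow_ne_zero 2 (Real.smoothTransition.pos_of_pos (by norm_num)).ne'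
  refine ⟨fun ξ => b ξ / √(∫ ξ, b ξ ^ 2), hsm.div_const _, fun ξ η h => ?_, fun ξ hξ => ?_, ?_⟩
  · simp only [hb, h]
  · rw [h0 ξ hξ, zero_div]
  · simp only [div_pow, Real.sq_sqrt hpos.le]
    rw [integral_div, div_self hpos.ne']

/-! ### Finite measures on the torus and their Fourier coefficients -/

section TorusMeasure

variable {ι : Type*} [Fintype ι]

theorem pi_haarAddCircle :
    (Measure.pi fun _ : ι => (AddCircle.haarAddCircle : Measure UnitAddCircle)) =
      (volume : Measure (UnitAddTorus ι)) := by
  rw [volume_pi]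
  congr 1; ext1 i
  rw [AddCircle.volume_eq_smul_haarAddCircle, ENNReal.ofReal_one, one_smul]

theorem mFourierCoeff_eq (f : UnitAddTorus ι → ℂ) (k : ι → ℤ) :
    UnitAddTorus.mFourierCoeff f k = ∫ x, UnitAddTorus.mFourier (-k) x * f x := by
  rw [← pi_haarAddCircle]; rfl

instance isNegInvariant_volume_unitAddTorus :
    (volume : Measure (UnitAddTorus ι)).IsNegInvariant := by
  have : (volume : Measure UnitAddCircle).IsNegInvariant := inferInstance
  infer_instance

theorem integral_mFourier (k : ι → ℤ) [Decidable (k = 0)] :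
    ∫ x, UnitAddTorus.mFourier k x = if k = 0 then 1 else 0 := by
  classical
  have h := (orthonormal_iff_ite.1 (UnitAddTorus.orthonormal_mFourier (d := ι))) 0 k
  simp only [ContinuousMap.inner_toLp, ← UnitAddTorus.mFourier_neg, ← UnitAddTorus.mFourier_add,
    neg_zero, add_zero] at h
  rw [← pi_haarAddCircle]
  refine h.trans ?_
  simp only [eq_comm]

/-- A finite measure on the torus is determined by its Fourier coefficients. -/
theorem ext_of_integral_mFourier_eq {P P' : Measure (UnitAddTorus ι)} [IsFiniteMeasure P]
    [IsFiniteMeasure P']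
    (h : ∀ k, ∫ x, UnitAddTorus.mFourier k x ∂P = ∫ x, UnitAddTorus.mFourier k x ∂P') :
    P = P' := by
  -- The characters span a point-separating star subalgebra, which determines a finite measure.
  refine ext_of_forall_mem_subalgebra_integral_eq_of_polish (𝕜 := ℂ)
    (A := (UnitAddTorus.mFourierSubalgebra ι).comap
      (BoundedContinuousFunction.toContinuousMapStarₐ ℂ)) ?_ fun g hg => ?_
  · intro x y hxy
    obtain ⟨f, ⟨g, hg, rfl⟩, hfg⟩ := UnitAddTorus.mFourierSubalgebra_separatesPoints hxy
    exact ⟨g, ⟨g, ⟨BoundedContinuousFunction.mkOfCompact g, hg, rfl⟩, rfl⟩, hfg⟩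
  · have hint : ∀ (Q : Measure (UnitAddTorus ι)) [IsFiniteMeasure Q] (f : C(UnitAddTorus ι, ℂ)),
        Integrable f Q := fun Q _ f =>
      f.continuous.integrable_of_hasCompactSupport (HasCompactSupport.of_compactSpace f)
    have hg' : (g : C(UnitAddTorus ι, ℂ)) ∈
        Submodule.span ℂ (Set.range (UnitAddTorus.mFourier (d := ι))) := by
      rw [← UnitAddTorus.mFourierSubalgebra_coe]; exact hg
    change ∫ x, (g : C(UnitAddTorus ι, ℂ)) x ∂P = ∫ x, (g : C(UnitAddTorus ι, ℂ)) x ∂P'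
    generalize (g : C(UnitAddTorus ι, ℂ)) = F at hg' ⊢
    induction hg' using Submodule.span_induction with
    | mem f hf => obtain ⟨k, rfl⟩ := hf; exact h k
    | zero => simp
    | add f₁ f₂ _ _ h₁ h₂ =>
      simp only [ContinuousMap.add_apply]
      rw [integral_add (hint P f₁) (hint P f₂), integral_add (hint P' f₁) (hint P' f₂), h₁, h₂]
    | smul c f _ hf =>
      simp only [ContinuousMap.smul_apply, integral_smul, hf]

theorem integral_withDensity_ofReal {X : Type*} [MeasurableSpace X] {μ : Measure X} {g : X → ℝ}
    (hg : Measurable g) (f : X → ℂ) :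
    ∫ x, f x ∂(μ.withDensity fun x => ENNReal.ofReal (g x)) = ∫ x, (max (g x) 0 : ℝ) * f x ∂μ := by
  rw [integral_withDensity_eq_integral_toReal_smul hg.ennreal_ofReal
    (.of_forall fun _ => ENNReal.ofReal_lt_top)]
  simp only [ENNReal.toReal_ofReal', Complex.real_smul]

/-- If a finite measure `ν` on the torus has the same Fourier coefficients as the continuous real
function `q`, then `ν` has density `q`. -/
theorem integral_eq_of_integral_mFourier_eq {ν : Measure (UnitAddTorus ι)} [IsFiniteMeasure ν]
    {q : UnitAddTorus ι → ℝ} (hq : Continuous q)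
    (h : ∀ k, ∫ x, UnitAddTorus.mFourier k x ∂ν = ∫ x, (q x : ℂ) * UnitAddTorus.mFourier k x) :
    ν ≪ volume ∧ ∀ (f : UnitAddTorus ι → ℂ) (C : ℝ), AEStronglyMeasurable f volume →
      (∀ x, ‖f x‖ ≤ C) → ∫ x, f x ∂ν = ∫ x, (q x : ℂ) * f x := by
  have hdens : ∀ g : UnitAddTorus ι → ℝ, Continuous g →
      IsFiniteMeasure (volume.withDensity fun x => ENNReal.ofReal (g x)) := fun g hg =>
    isFiniteMeasure_withDensity_ofReal
      (hg.integrable_of_hasCompactSupport (HasCompactSupport.of_compactSpace g)).2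
  have hqn : Continuous fun x => -q x := hq.neg
  have := hdens q hq
  have := hdens (fun x => -q x) hqn
  have hmul : ∀ (g : UnitAddTorus ι → ℝ), Continuous g → ∀ (f : UnitAddTorus ι → ℂ) (C : ℝ),
      AEStronglyMeasurable f volume → (∀ x, ‖f x‖ ≤ C) →
      Integrable (fun x => (max (g x) 0 : ℝ) * f x) := fun g hg f C hf hC => by
    have h1 : Integrable (fun x => ((max (g x) 0 : ℝ) : ℂ)) :=
      Continuous.integrable_of_hasCompactSupport (by fun_prop) (HasCompactSupport.of_compactSpace _)
    exact h1.mul_bdd hf (.of_forall hC)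
  have hsub : ∀ (f : UnitAddTorus ι → ℂ) (C : ℝ), AEStronglyMeasurable f volume →
      (∀ x, ‖f x‖ ≤ C) →
      ∫ x, (max (q x) 0 : ℝ) * f x = (∫ x, (q x : ℂ) * f x) + ∫ x, (max (-q x) 0 : ℝ) * f x := by
    intro f C hf hC
    rw [← sub_eq_iff_eq_add, ← integral_sub (hmul q hq f C hf hC) (hmul _ hqn f C hf hC)]
    congr 1; ext x
    rw [← sub_mul, ← Complex.ofReal_sub]
    congr 2
    rcases le_total 0 (q x) with h | h
    · rw [max_eq_left h, max_eq_right (by linarith)]; ring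
    · rw [max_eq_right h, max_eq_left (by linarith)]; ring
  -- No sign is known for `q`, so its negative part is moved to the other side: both sides are then
  -- finite positive measures with equal Fourier coefficients.
  have key : ν + (volume.withDensity fun x => ENNReal.ofReal (-q x)) =
      volume.withDensity fun x => ENNReal.ofReal (q x) := by
    refine ext_of_integral_mFourier_eq fun k => ?_
    have hi : ∀ (Q : Measure (UnitAddTorus ι)) [IsFiniteMeasure Q],
        Integrable (UnitAddTorus.mFourier k) Q := fun Q _ =>
      (UnitAddTorus.mFourier k).continuous.integrable_of_hasCompactSupport
        (HasCompactSupport.of_compactSpace _)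
    rw [integral_add_measure (hi _) (hi _), integral_withDensity_ofReal hq.measurable,
      integral_withDensity_ofReal hqn.measurable, h,
      hsub _ 1 (UnitAddTorus.mFourier k).continuous.aestronglyMeasurable fun x => ?_]
    exact ((UnitAddTorus.mFourier k).norm_coe_le_norm x).trans_eq UnitAddTorus.mFourier_norm
  -- By `key`, `ν` is dominated by the measure with density `q⁺`.
  have hac : ν ≪ volume :=
    (Measure.absolutelyContinuous_of_le (Measure.le_add_right le_rfl)).trans
      (key ▸ withDensity_absolutelyContinuous _ _)
  refine ⟨hac, fun f C hf hC => ?_⟩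
  have hi : ∀ (Q : Measure (UnitAddTorus ι)) [IsFiniteMeasure Q], Q ≪ volume →
      Integrable f Q := fun Q _ hQ =>
    (integrable_const C).mono' (hf.mono_ac hQ) (.of_forall hC)
  have h1 : ∫ x, f x ∂(ν + (volume.withDensity fun x => ENNReal.ofReal (-q x))) =
      ∫ x, f x ∂(volume.withDensity fun x => ENNReal.ofReal (q x)) := by rw [key]
  rw [integral_add_measure (hi _ hac) (hi _ (withDensity_absolutelyContinuous _ _)),
    integral_withDensity_ofReal hq.measurable,
    integral_withDensity_ofReal hqn.measurable, hsub f C hf hC] at h1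
  exact add_right_cancel h1

end TorusMeasure

/-! ### Smoothing on the torus as a trigonometric polynomial -/

section

variable {d : ℕ}

/-- The projection `ℝ^d → ℝ^d / ℤ^d`. -/
def toTorus (y : EuclideanSpace ℝ (Fin d)) : UnitAddTorus (Fin d) := fun i => (y i : UnitAddCircle)

theorem continuous_toTorus : Continuous (toTorus (d := d)) :=
  continuous_pi fun i => (AddCircle.continuous_mk' 1).comp (by fun_prop)

/-- A frequency as a vector of `ℝ^d`. -/
def freqVec (k : Fin d → ℤ) : EuclideanSpace ℝ (Fin d) := WithLp.toLp 2 fun i => (k i : ℝ)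

theorem norm_freqVec (k : Fin d → ℤ) : ‖freqVec k‖ = freqNorm k := rfl

theorem freqVec_neg (k : Fin d → ℤ) : freqVec (-k) = -freqVec k := by
  ext i; simp [freqVec]

theorem freqNorm_neg (k : Fin d → ℤ) : freqNorm (-k) = freqNorm k := by
  rw [← norm_freqVec, freqVec_neg, norm_neg, norm_freqVec]

theorem freqVec_zero : freqVec (0 : Fin d → ℤ) = 0 := by
  ext i; simp [freqVec]

theorem freqNorm_eq_zero {k : Fin d → ℤ} : freqNorm k = 0 ↔ k = 0 := by
  rw [← norm_freqVec, norm_eq_zero]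
  refine ⟨fun h => funext fun i => ?_, fun h => h ▸ freqVec_zero⟩
  have : freqVec k i = 0 := by rw [h]; rfl
  exact Int.cast_eq_zero.1 this

theorem mem_freqs {R : ℝ} {k : Fin d → ℤ} : k ∈ freqs d R ↔ k ≠ 0 ∧ freqNorm k < R := by
  rw [freqs, Set.Finite.mem_toFinset, Set.mem_ofPred_eq, Ne, ← freqNorm_eq_zero,
    ← norm_freqVec, (norm_nonneg (freqVec k)).lt_iff_ne']

theorem mFourier_toTorus (k : Fin d → ℤ) (y : EuclideanSpace ℝ (Fin d)) :
    UnitAddTorus.mFourier k (toTorus y) =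
      Complex.exp ((2 * Real.pi * inner ℝ (freqVec k) y : ℝ) * Complex.I) := by
  simp only [UnitAddTorus.mFourier, ContinuousMap.coe_mk, toTorus, fourier_coe_apply,
    ← Complex.exp_sum]
  congr 1
  simp only [freqVec, PiLp.inner_apply]
  push_cast
  rw [Finset.mul_sum, Finset.sum_mul]
  refine Finset.sum_congr rfl fun i _ => ?_
  simp
  ring_nf

theorem mFourier_sub (k : Fin d → ℤ) (x y : UnitAddTorus (Fin d)) :
    UnitAddTorus.mFourier k (x - y) =
      UnitAddTorus.mFourier k x * UnitAddTorus.mFourier (-k) y := by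
  simp only [UnitAddTorus.mFourier, ContinuousMap.coe_mk, ← Finset.prod_mul_distrib]
  refine Finset.prod_congr rfl fun i _ => ?_
  simp only [fourier_apply, Pi.sub_apply, Pi.neg_apply, sub_eq_add_neg, smul_add, smul_neg,
    neg_smul, AddCircle.toCircle_add, Circle.coe_mul]

/-- The probability measure on `ℝ^d` with density `kernel w`. -/
noncomputable def kernelMeasure (w : EuclideanSpace ℝ (Fin d) → ℝ) : Measure (EuclideanSpace ℝ (Fin d)) :=
  volume.withDensity fun y => ENNReal.ofReal (kernel w y)

/-- The average of `f` over translations by `-y / R`, where `y` has density `kernel w`. -/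
noncomputable def smoothing (w : EuclideanSpace ℝ (Fin d) → ℝ) (R : ℝ) (f : UnitAddTorus (Fin d) → ℝ)
    (x : UnitAddTorus (Fin d)) : ℝ :=
  ∫ y, f (x - toTorus (R⁻¹ • y)) ∂kernelMeasure w

theorem continuous_scaled_toTorus (R : ℝ) :
    Continuous fun y : EuclideanSpace ℝ (Fin d) => toTorus (R⁻¹ • y) :=
  continuous_toTorus.comp (continuous_const_smul _)

namespace IsProfile

variable {w : EuclideanSpace ℝ (Fin d) → ℝ} (hw : IsProfile w)
include hw

theorem kernelMeasure_real_apply {s : Set (EuclideanSpace ℝ (Fin d))} (hs : MeasurableSet s) :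
    (kernelMeasure w).real s = ∫ y in s, kernel w y := by
  rw [measureReal_def, kernelMeasure, withDensity_apply _ hs,
    ← ofReal_integral_eq_lintegral_ofReal hw.kernel_integrable.integrableOn
      (.of_forall fun y => (hw.kernel_pos y).le),
    ENNReal.toReal_ofReal (integral_nonneg fun y => (hw.kernel_pos y).le)]

theorem isProbabilityMeasure_kernelMeasure : IsProbabilityMeasure (kernelMeasure w) := by
  constructor
  rw [kernelMeasure, withDensity_apply _ MeasurableSet.univ, Measure.restrict_univ,
    ← ofReal_integral_eq_lintegral_ofReal hw.kernel_integrable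
      (.of_forall fun y => (hw.kernel_pos y).le), hw.integral_kernel, ENNReal.ofReal_one]

theorem integral_mFourier_map (R : ℝ) (k : Fin d → ℤ) :
    ∫ x, UnitAddTorus.mFourier k x ∂((kernelMeasure w).map fun y => toTorus (R⁻¹ • y)) =
      kernelHat w (R⁻¹ • freqVec k) := by
  rw [integral_map (continuous_scaled_toTorus R).measurable.aemeasurable
    (UnitAddTorus.mFourier k).continuous.aestronglyMeasurable, kernelMeasure,
    integral_withDensity_ofReal hw.kernel_continuous.measurable, ← hw.kernelHat_neg,
    ← hw.fourier_kernel, Real.fourier_eq']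
  congr 1; ext y
  rw [max_eq_left (hw.kernel_pos y).le, mFourier_toTorus, mul_comm, smul_eq_mul, inner_neg_right,
    real_inner_smul_right, real_inner_smul_right, real_inner_comm]
  congr 3
  ring_nf

/-- The transform vanishes already at norm exactly 1, which is why the strict range `|k| < R`
suffices. -/
theorem kernelHat_freq_eq_zero {R : ℝ} (hR : 0 < R) {k : Fin d → ℤ} (hk : k ∉ insert 0 (freqs d R)) :
    kernelHat w (R⁻¹ • freqVec k) = 0 := by
  refine hw.kernelHat_eq_zero ?_
  rw [Finset.mem_insert, mem_freqs] at hk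
  push Not at hk
  rw [norm_smul, norm_freqVec, Real.norm_of_nonneg (inv_pos.2 hR).le, ← div_eq_inv_mul,
    one_le_div hR]
  exact hk.2 hk.1

/-- The measure `map (y ↦ y / R) (kernelMeasure w)` on the torus has a trigonometric polynomial as
its density. -/
theorem map_kernelMeasure {R : ℝ} (hR : 0 < R) :
    (kernelMeasure w).map (fun y => toTorus (R⁻¹ • y)) ≪ volume ∧
    ∀ (f : UnitAddTorus (Fin d) → ℂ) (C : ℝ), AEStronglyMeasurable f volume → (∀ x, ‖f x‖ ≤ C) →
      ∫ x, f x ∂((kernelMeasure w).map fun y => toTorus (R⁻¹ • y)) =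
        ∫ x, (∑ k ∈ insert 0 (freqs d R), (kernelHat w (R⁻¹ • freqVec k) : ℂ) *
          UnitAddTorus.mFourier k x) * f x := by
  have := hw.isProbabilityMeasure_kernelMeasure
  have := Measure.isProbabilityMeasure_map (μ := kernelMeasure w)
    (continuous_scaled_toTorus (d := d) R).measurable.aemeasurable
  set Q : UnitAddTorus (Fin d) → ℂ := fun x => ∑ k ∈ insert 0 (freqs d R),
    (kernelHat w (R⁻¹ • freqVec k) : ℂ) * UnitAddTorus.mFourier k x with hQ
  have hQc : Continuous Q := by fun_prop
  have hneg : ∀ k : Fin d → ℤ, kernelHat w (R⁻¹ • freqVec (-k)) = kernelHat w (R⁻¹ • freqVec k) :=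
    fun k => by rw [freqVec_neg, smul_neg, hw.kernelHat_neg]
  -- Both the frequency set and the coefficients are symmetric under `k ↦ -k`.
  have hreal : ∀ x, ((Q x).re : ℂ) = Q x := fun x => by
    refine Complex.conj_eq_iff_re.1 ?_
    simp only [hQ, map_sum, map_mul, Complex.conj_ofReal, ← UnitAddTorus.mFourier_neg]
    refine Finset.sum_equiv (Equiv.neg _) (fun k => ?_) fun k _ => ?_
    · simp only [Equiv.neg_apply, Finset.mem_insert, mem_freqs, freqNorm_neg, neg_eq_zero, Ne]
    · rw [Equiv.neg_apply, hneg]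
  have := integral_eq_of_integral_mFourier_eq
    (ν := (kernelMeasure w).map fun y => toTorus (R⁻¹ • y)) (q := fun x => (Q x).re)
    (Complex.continuous_re.comp hQc) fun k => ?_
  · simpa only [hreal] using this
  · simp only [hreal]
    rw [hw.integral_mFourier_map]
    simp only [hQ, Finset.sum_mul, mul_assoc, ← UnitAddTorus.mFourier_add]
    rw [integral_finsetSum _ fun j _ => Integrable.const_mul
      ((UnitAddTorus.mFourier (j + k)).continuous.integrable_of_hasCompactSupport
        (HasCompactSupport.of_compactSpace _)) _]
    simp only [integral_const_mul, integral_mFourier, add_eq_zero_iff_eq_neg, mul_ite, mul_one,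
      mul_zero, Finset.sum_ite_eq', hneg]
    split_ifs with h
    · rfl
    · rw [← hneg, hw.kernelHat_freq_eq_zero hR h, Complex.ofReal_zero]

/-- The pushforward of the kernel measure is absolutely continuous, so null sets of the torus stay
invisible. Thus the smoothing is controlled at every `x`, even for merely null-measurable sets. -/
theorem aestronglyMeasurable_translate {R : ℝ} (hR : 0 < R) {f : UnitAddTorus (Fin d) → ℝ}
    (hf : AEStronglyMeasurable f volume) (x : UnitAddTorus (Fin d)) :
    AEStronglyMeasurable (fun y => f (x - toTorus (R⁻¹ • y))) (kernelMeasure w) := by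
  have h1 : AEStronglyMeasurable (fun z => f (x - z)) volume :=
    hf.comp_measurePreserving (Measure.measurePreserving_sub_left volume x)
  exact (h1.mono_ac (hw.map_kernelMeasure hR).1).comp_measurable
    (continuous_scaled_toTorus R).measurable

theorem integrable_translate {R : ℝ} (hR : 0 < R) {f : UnitAddTorus (Fin d) → ℝ} {C : ℝ}
    (hf : AEStronglyMeasurable f volume) (hC : ∀ x, |f x| ≤ C) (x : UnitAddTorus (Fin d)) :
    Integrable (fun y => f (x - toTorus (R⁻¹ • y))) (kernelMeasure w) := by
  have := hw.isProbabilityMeasure_kernelMeasure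
  exact (integrable_const C).mono' (hw.aestronglyMeasurable_translate hR hf x)
    (.of_forall fun y => hC _)

/-- The smoothing of a bounded function is a trigonometric polynomial. -/
theorem ofReal_smoothing {R : ℝ} (hR : 0 < R) {f : UnitAddTorus (Fin d) → ℝ} {C : ℝ}
    (hf : AEStronglyMeasurable f volume) (hC : ∀ x, |f x| ≤ C) (x : UnitAddTorus (Fin d)) :
    (smoothing w R f x : ℂ) = coeff f 0 + ∑ k ∈ freqs d R,
      (kernelHat w (R⁻¹ • freqVec k) : ℂ) * coeff f k * UnitAddTorus.mFourier k x := by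
  have h1 : AEStronglyMeasurable (fun z => (f (x - z) : ℂ)) volume :=
    Complex.continuous_ofReal.comp_aestronglyMeasurable
      (hf.comp_measurePreserving (Measure.measurePreserving_sub_left volume x))
  have hC' : ∀ z, ‖(f (x - z) : ℂ)‖ ≤ C := fun z => by
    rw [Complex.norm_real]; exact hC _
  obtain ⟨hac, hint⟩ := hw.map_kernelMeasure hR
  have h2 := hint _ C h1 hC'
  rw [integral_map (continuous_scaled_toTorus R).measurable.aemeasurable (h1.mono_ac hac)] at h2
  rw [smoothing, ← integral_complex_ofReal, h2]
  have hfi : Integrable (fun z => (f (x - z) : ℂ)) := (integrable_const C).mono' h1 (.of_forall hC')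
  simp only [Finset.sum_mul, mul_assoc]
  rw [integral_finsetSum _ fun k _ => Integrable.const_mul (hfi.bdd_mul (c := 1)
    (UnitAddTorus.mFourier k).continuous.aestronglyMeasurable (.of_forall fun z =>
      ((UnitAddTorus.mFourier k).norm_coe_le_norm z).trans_eq UnitAddTorus.mFourier_norm)) _]
  have h3 : ∀ k : Fin d → ℤ, ∫ z, UnitAddTorus.mFourier k z * (f (x - z) : ℂ) =
      coeff f k * UnitAddTorus.mFourier k x := fun k => by
    -- Substituting `z ↦ x - z` splits the character into its value at `x` times the conjugate
    -- character in `z`.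
    rw [← integral_sub_left_eq_self _ volume x]
    simp only [sub_sub_cancel, mFourier_sub]
    rw [coeff, mFourierCoeff_eq, ← integral_mul_const]
    congr 1; ext z
    ring
  simp only [integral_const_mul, h3]
  rw [Finset.sum_insert (by simp [mem_freqs]), freqVec_zero, smul_zero, hw.kernelHat_zero,
    UnitAddTorus.mFourier_zero]
  simp

end IsProfile

end

/-! ### Distance to the boundary and pointwise bounds -/

variable {d : ℕ}

theorem dist_sub_toTorus_le (x : UnitAddTorus (Fin d)) (y : EuclideanSpace ℝ (Fin d)) :
    dist (WithLp.toLp 2 (x - toTorus y) : PiLp 2 (fun _ : Fin d => UnitAddCircle))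
      (WithLp.toLp 2 x) ≤ ‖y‖ := by
  rw [PiLp.dist_eq_of_L2, EuclideanSpace.norm_eq]
  refine Real.sqrt_le_sqrt (Finset.sum_le_sum fun i _ => pow_le_pow_left₀ dist_nonneg ?_ 2)
  rw [dist_eq_norm]
  simp only [Pi.sub_apply, sub_sub_cancel_left, norm_neg]
  exact QuotientAddGroup.norm_mk_le_norm

theorem torusInfDist_sub_toTorus_le (x : UnitAddTorus (Fin d)) (S : Set (UnitAddTorus (Fin d)))
    (y : EuclideanSpace ℝ (Fin d)) :
    torusInfDist (x - toTorus y) S ≤ torusInfDist x S + ‖y‖ :=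
  Metric.infDist_le_infDist_add_dist.trans (add_le_add le_rfl (dist_sub_toTorus_le x y))

theorem torusInfDist_nonneg (x : UnitAddTorus (Fin d)) (S : Set (UnitAddTorus (Fin d))) :
    0 ≤ torusInfDist x S := Metric.infDist_nonneg

theorem continuous_torusInfDist (S : Set (UnitAddTorus (Fin d))) :
    Continuous fun x => torusInfDist x S :=
  (Metric.continuous_infDist_pt _).comp (PiLp.continuous_toLp 2 _)

/-- Translations shorter than the distance to the boundary do not leave a set or its complement. -/
theorem mem_iff_of_norm_lt_torusInfDist {Ω : Set (UnitAddTorus (Fin d))}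
    {x : UnitAddTorus (Fin d)} {y : EuclideanSpace ℝ (Fin d)}
    (h : ‖y‖ < torusInfDist x (frontier Ω)) : x - toTorus y ∈ Ω ↔ x ∈ Ω := by
  -- The projected segment from `x` to `x - y` is connected and stays within `‖y‖` of `x`, so it
  -- misses the frontier and lies on one side. For an empty frontier the distance defaults to 0 and
  -- the hypothesis fails.
  set c : ℝ → UnitAddTorus (Fin d) := fun s => x - toTorus (s • y) with hc
  have hcont : Continuous c :=
    continuous_const.sub (continuous_toTorus.comp (continuous_id.smul continuous_const))
  have hpre : IsPreconnected (c '' Set.Icc 0 1) :=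
    isPreconnected_Icc.image c hcont.continuousOn
  have hdisj : Disjoint (frontier Ω) (c '' Set.Icc 0 1) := by
    rw [Set.disjoint_left]
    rintro _ hz ⟨s, hs, rfl⟩
    have h1 : torusInfDist x (frontier Ω) ≤ ‖s • y‖ :=
      (Metric.infDist_le_dist_of_mem (Set.mem_image_of_mem _ hz)).trans
        ((dist_comm _ _).trans_le (dist_sub_toTorus_le x _))
    have h2 : ‖s • y‖ ≤ ‖y‖ := by
      rw [norm_smul, Real.norm_of_nonneg hs.1]
      exact mul_le_of_le_one_left (norm_nonneg _) hs.2
    linarith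
  have h0 : x ∈ c '' Set.Icc 0 1 := ⟨0, by simp, by
    simp only [hc, zero_smul]; ext i; simp [toTorus]⟩
  have h1 : x - toTorus y ∈ c '' Set.Icc 0 1 := ⟨1, by simp, by simp only [hc, one_smul]⟩
  have hsub : c '' Set.Icc 0 1 ⊆ interior Ω ∪ interior Ωᶜ := fun z hz => by
    by_contra hn
    refine Set.disjoint_left.1 hdisj ?_ hz
    rw [frontier_eq_closure_inter_closure, closure_compl, closure_eq_compl_interior_compl]
    rw [Set.mem_union, not_or] at hn
    exact ⟨hn.2, hn.1⟩
  have key : c '' Set.Icc 0 1 ⊆ Ω ∨ c '' Set.Icc 0 1 ⊆ Ωᶜ := by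
    rcases hpre.subset_or_subset isOpen_interior isOpen_interior
      ((disjoint_compl_right (a := Ω)).mono interior_subset interior_subset) hsub with h | h
    · exact .inl (h.trans interior_subset)
    · exact .inr (h.trans interior_subset)
  rcases key with h | h
  · exact iff_of_true (h h1) (h h0)
  · exact iff_of_false (h h1) (h h0)

theorem boundaryTerm_eq {w : EuclideanSpace ℝ (Fin d) → ℝ} {Ω : Set (UnitAddTorus (Fin d))}
    (hΩ : (frontier Ω).Nonempty) (R : ℝ) (x : UnitAddTorus (Fin d)) :
    boundaryTerm w Ω R x = gam w * tail w (R * torusInfDist x (frontier Ω)) := by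
  rw [boundaryTerm, if_pos hΩ, psi]
  rw [show 2 * R * torusInfDist x (frontier Ω) / 2 = R * torusInfDist x (frontier Ω) by ring]
  ring

theorem abs_indicator_one_le {α : Type*} (s : Set α) (x : α) :
    |s.indicator (fun _ => (1 : ℝ)) x| ≤ 1 := by
  by_cases h : x ∈ s <;> simp [h]

theorem aestronglyMeasurable_indicator_one {α : Type*} [MeasurableSpace α] {μ : Measure α}
    {s : Set α} (hs : NullMeasurableSet s μ) :
    AEStronglyMeasurable (s.indicator fun _ => (1 : ℝ)) μ :=
  aestronglyMeasurable_const.indicator₀ hs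

theorem coeff_indicator_zero {Ω : Set (UnitAddTorus (Fin d))} (hΩ : NullMeasurableSet Ω volume) :
    coeff (Ω.indicator fun _ => (1 : ℝ)) 0 = volume.real Ω := by
  rw [coeff, mFourierCoeff_eq, neg_zero, UnitAddTorus.mFourier_zero]
  simp only [ContinuousMap.one_apply, one_mul]
  rw [integral_complex_ofReal, integral_indicator₀ hΩ]
  simp

namespace IsProfile

variable {w : EuclideanSpace ℝ (Fin d) → ℝ} (hw : IsProfile w)
include hw

theorem abs_boundaryTerm_le (Ω : Set (UnitAddTorus (Fin d))) (R : ℝ) (x : UnitAddTorus (Fin d)) :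
    |boundaryTerm w Ω R x| ≤ gam w := by
  by_cases hΩ : (frontier Ω).Nonempty
  · rw [boundaryTerm_eq hΩ, abs_of_nonneg (mul_nonneg hw.gam_pos.le (hw.tail_nonneg _))]
    exact mul_le_of_le_one_right hw.gam_pos.le (hw.tail_le_one _)
  · rw [boundaryTerm, if_neg hΩ, abs_zero]
    exact hw.gam_pos.le

theorem measurable_boundaryTerm (Ω : Set (UnitAddTorus (Fin d))) (R : ℝ) :
    Measurable (boundaryTerm w Ω R) := by
  by_cases hΩ : (frontier Ω).Nonempty
  · rw [funext (boundaryTerm_eq hΩ R)]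
    exact (hw.tail_antitone.measurable.comp
      ((continuous_torusInfDist _).measurable.const_mul R)).const_mul _
  · have : boundaryTerm w Ω R = fun _ => 0 := funext fun x => by rw [boundaryTerm, if_neg hΩ]
    rw [this]; exact measurable_const

theorem kernelMeasure_real_tail (t : ℝ) :
    (kernelMeasure w).real {y | t ≤ ‖y‖} = tail w t :=
  hw.kernelMeasure_real_apply (measurableSet_le measurable_const measurable_norm)

/-- Only translations with `‖y‖ ≥ R dist(x, ∂Ω)` can change the indicator, and then by at most 1.
With empty frontier the distance defaults to 0 and the bound is still valid. -/
theorem abs_indicator_sub_smoothing_le {R : ℝ} (hR : 0 < R) {Ω : Set (UnitAddTorus (Fin d))}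
    (hΩ : NullMeasurableSet Ω volume) (x : UnitAddTorus (Fin d)) :
    |Ω.indicator (fun _ => (1 : ℝ)) x - smoothing w R (Ω.indicator fun _ => (1 : ℝ)) x| ≤
      tail w (R * torusInfDist x (frontier Ω)) := by
  have := hw.isProbabilityMeasure_kernelMeasure
  set t := R * torusInfDist x (frontier Ω) with ht
  have hms : MeasurableSet {y : EuclideanSpace ℝ (Fin d) | t ≤ ‖y‖} :=
    measurableSet_le measurable_const measurable_norm
  have hi := hw.integrable_translate hR (aestronglyMeasurable_indicator_one hΩ)
    (abs_indicator_one_le Ω) x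
  have hc : Ω.indicator (fun _ => (1 : ℝ)) x =
      ∫ _, Ω.indicator (fun _ => (1 : ℝ)) x ∂kernelMeasure w := by simp
  rw [← hw.kernelMeasure_real_tail, ← integral_indicator_one hms, smoothing, hc,
    ← integral_sub (integrable_const _) hi, ← Real.norm_eq_abs]
  refine norm_integral_le_of_norm_le ((integrable_const (1 : ℝ)).indicator hms)
    (.of_forall fun y => ?_)
  by_cases hy : t ≤ ‖y‖
  · rw [Set.indicator_of_mem (show y ∈ {y | t ≤ ‖y‖} from hy), Real.norm_eq_abs, abs_le]
    simp only [Pi.one_apply]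
    have h0 : ∀ z, 0 ≤ Ω.indicator (fun _ => (1 : ℝ)) z :=
      Set.indicator_nonneg fun _ _ => zero_le_one
    have h1 : ∀ z, Ω.indicator (fun _ => (1 : ℝ)) z ≤ 1 := fun z =>
      (le_abs_self _).trans (abs_indicator_one_le Ω z)
    have := h0 x; have := h1 x
    have := h0 (x - toTorus (R⁻¹ • y)); have := h1 (x - toTorus (R⁻¹ • y))
    constructor <;> linarith
  · have hlt : ‖R⁻¹ • y‖ < torusInfDist x (frontier Ω) := by
      rw [norm_smul, Real.norm_of_nonneg (inv_pos.2 hR).le, inv_mul_lt_iff₀ hR]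
      exact not_le.1 hy
    have hiff := mem_iff_of_norm_lt_torusInfDist hlt
    rw [Set.indicator_of_notMem (show y ∉ {y | t ≤ ‖y‖} from hy)]
    by_cases hx : x ∈ Ω
    · rw [Set.indicator_of_mem hx, Set.indicator_of_mem (hiff.2 hx)]; simp
    · rw [Set.indicator_of_notMem hx, Set.indicator_of_notMem (fun h => hx (hiff.1 h))]; simp

/-- For `‖y‖ ≤ 1` the translate by `y / R` raises `R dist` by at most 1, so the unit-shift bound for
`tail` applies. The constant `γ` is chosen so that the ball `‖y‖ ≤ 1` alone recovers the full tail;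
the remaining `y` contribute nonnegatively. -/
theorem tail_le_smoothing_boundaryTerm (hd : 1 ≤ d) {R : ℝ} (hR : 0 < R)
    {Ω : Set (UnitAddTorus (Fin d))} (hΩ : (frontier Ω).Nonempty) (x : UnitAddTorus (Fin d)) :
    tail w (R * torusInfDist x (frontier Ω)) ≤ smoothing w R (boundaryTerm w Ω R) x := by
  have := hw.isProbabilityMeasure_kernelMeasure
  set t := R * torusInfDist x (frontier Ω) with ht
  have ht0 : 0 ≤ t := mul_nonneg hR.le (torusInfDist_nonneg _ _)
  have hms : MeasurableSet {y : EuclideanSpace ℝ (Fin d) | ‖y‖ ≤ 1} :=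
    measurableSet_le measurable_norm measurable_const
  set m := ∫ y in {y : EuclideanSpace ℝ (Fin d) | ‖y‖ ≤ 1}, kernel w y with hm
  have hmpos : 0 < m := hw.setIntegral_closedBall_pos
  have hg := hw.gam_pos
  have hgm : gam w * (Real.exp (-(2 * Real.pi)) * m) = 1 :=
    inv_mul_cancel₀ (mul_pos (Real.exp_pos _) hmpos).ne'
  calc tail w t = gam w * m * (Real.exp (-(2 * Real.pi)) * tail w t) := by
        linear_combination -(tail w t) * hgm
    _ ≤ gam w * m * tail w (t + 1) := by
        gcongr; exact hw.exp_mul_tail_le hd ht0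
    _ = ∫ y, {y : EuclideanSpace ℝ (Fin d) | ‖y‖ ≤ 1}.indicator
          (fun _ => gam w * tail w (t + 1)) y ∂kernelMeasure w := by
        rw [integral_indicator_const _ hms, hw.kernelMeasure_real_apply hms, smul_eq_mul, ← hm]
        ring
    _ ≤ _ := by
        refine integral_mono ((integrable_const _).indicator hms) (hw.integrable_translate hR
          (hw.measurable_boundaryTerm Ω R).aestronglyMeasurable (hw.abs_boundaryTerm_le Ω R) x)
          fun y => ?_
        by_cases hy : y ∈ {y : EuclideanSpace ℝ (Fin d) | ‖y‖ ≤ 1}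
        · rw [Set.indicator_of_mem hy, boundaryTerm_eq hΩ]
          refine mul_le_mul_of_nonneg_left (hw.tail_antitone ?_) hg.le
          have hy : ‖y‖ ≤ 1 := hy
          have h1 := torusInfDist_sub_toTorus_le x (frontier Ω) (R⁻¹ • y)
          rw [norm_smul, Real.norm_of_nonneg (inv_pos.2 hR).le] at h1
          calc R * torusInfDist (x - toTorus (R⁻¹ • y)) (frontier Ω)
              ≤ R * (torusInfDist x (frontier Ω) + R⁻¹ * ‖y‖) := by gcongr
            _ = t + ‖y‖ := by rw [ht]; field_simp
            _ ≤ t + 1 := by gcongr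
        · rw [Set.indicator_of_notMem hy, boundaryTerm_eq hΩ]
          exact mul_nonneg hg.le (hw.tail_nonneg _)

/-! ### Averaging over the points and conclusion -/

/-- The average of a smoothing over a finite point set, in terms of exponential sums. -/
theorem ofReal_mean_smoothing {R : ℝ} (hR : 0 < R) {f : UnitAddTorus (Fin d) → ℝ} {C : ℝ}
    (hf : AEStronglyMeasurable f volume) (hC : ∀ x, |f x| ≤ C) {m : ℕ} (hm : 1 ≤ m)
    (x : Fin m → UnitAddTorus (Fin d)) :
    (((m : ℝ)⁻¹ * ∑ j, smoothing w R f (x j) : ℝ) : ℂ) = coeff f 0 + ∑ k ∈ freqs d R,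
      (kernelHat w (R⁻¹ • freqVec k) : ℂ) * coeff f k *
        ((m : ℂ)⁻¹ * ∑ j, UnitAddTorus.mFourier k (x j)) := by
  have hm0 : (m : ℂ) ≠ 0 := Nat.cast_ne_zero.2 (by lia)
  rw [Complex.ofReal_mul, Complex.ofReal_sum (s := Finset.univ)]
  simp only [hw.ofReal_smoothing hR hf hC, Finset.sum_add_distrib]
  rw [Finset.sum_comm, mul_add]
  congr 1
  · simp [hm0]
  · rw [Finset.mul_sum]
    refine Finset.sum_congr rfl fun k _ => ?_
    rw [← Finset.mul_sum]; push_cast; ring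

/-- The mean passes unchanged through the smoothing, and the other multipliers are bounded by 1. The
lemma is applied both to the indicator and to the boundary term. -/
theorem norm_mean_smoothing_sub_coeff_le {R : ℝ} (hR : 0 < R) {f : UnitAddTorus (Fin d) → ℝ}
    {C : ℝ} (hf : AEStronglyMeasurable f volume) (hC : ∀ x, |f x| ≤ C) {m : ℕ} (hm : 1 ≤ m)
    (x : Fin m → UnitAddTorus (Fin d)) :
    ‖(((m : ℝ)⁻¹ * ∑ j, smoothing w R f (x j) : ℝ) : ℂ) - coeff f 0‖ ≤ ∑ k ∈ freqs d R,
      ‖coeff f k‖ * ‖(m : ℂ)⁻¹ * ∑ j, UnitAddTorus.mFourier k (x j)‖ := by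
  have h := hw.ofReal_mean_smoothing hR hf hC hm x
  rw [h, add_sub_cancel_left]
  refine (norm_sum_le _ _).trans (Finset.sum_le_sum fun k _ => ?_)
  rw [norm_mul, norm_mul _ (coeff f k), Complex.norm_real, Real.norm_eq_abs]
  refine mul_le_mul_of_nonneg_right ?_ (norm_nonneg _)
  exact mul_le_of_le_one_left (norm_nonneg _) (hw.abs_kernelHat_le_one _)

/-- The Erdős–Turán inequality. -/
theorem abs_volume_sub_mean_le (hd : 1 ≤ d) {m : ℕ} (hm : 1 ≤ m)
    (x : Fin m → UnitAddTorus (Fin d)) {Ω : Set (UnitAddTorus (Fin d))}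
    (hΩ : NullMeasurableSet Ω volume) {R : ℝ} (hR : 0 < R) :
    |volume.real Ω - (m : ℝ)⁻¹ * ∑ j, Ω.indicator (fun _ => (1 : ℝ)) (x j)| ≤
      ‖coeff (boundaryTerm w Ω R) 0‖ + ∑ k ∈ freqs d R,
        (‖coeff (Ω.indicator (fun _ => (1 : ℝ))) k‖ + ‖coeff (boundaryTerm w Ω R) k‖) *
          ‖(m : ℂ)⁻¹ * ∑ j, UnitAddTorus.mFourier k (x j)‖ := by
  have hm0 : (m : ℝ) ≠ 0 := Nat.cast_ne_zero.2 (by lia)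
  by_cases hfr : (frontier Ω).Nonempty
  · have h1 := hw.norm_mean_smoothing_sub_coeff_le hR (aestronglyMeasurable_indicator_one hΩ)
      (abs_indicator_one_le Ω) hm x
    have h2 := hw.norm_mean_smoothing_sub_coeff_le hR
      (hw.measurable_boundaryTerm Ω R).aestronglyMeasurable (hw.abs_boundaryTerm_le Ω R) hm x
    rw [coeff_indicator_zero hΩ, ← Complex.ofReal_sub, Complex.norm_real, Real.norm_eq_abs] at h1
    have h3 : |(m : ℝ)⁻¹ * ∑ j, smoothing w R (boundaryTerm w Ω R) (x j)| ≤
        ‖coeff (boundaryTerm w Ω R) 0‖ + ∑ k ∈ freqs d R, ‖coeff (boundaryTerm w Ω R) k‖ *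
          ‖(m : ℂ)⁻¹ * ∑ j, UnitAddTorus.mFourier k (x j)‖ := by
      rw [← Real.norm_eq_abs, ← Complex.norm_real]
      have := norm_le_norm_add_norm_sub' (((m : ℝ)⁻¹ *
        ∑ j, smoothing w R (boundaryTerm w Ω R) (x j) : ℝ) : ℂ) (coeff (boundaryTerm w Ω R) 0)
      linarith
    have h4 : |(m : ℝ)⁻¹ * ∑ j, Ω.indicator (fun _ => (1 : ℝ)) (x j) -
        (m : ℝ)⁻¹ * ∑ j, smoothing w R (Ω.indicator fun _ => (1 : ℝ)) (x j)| ≤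
        (m : ℝ)⁻¹ * ∑ j, smoothing w R (boundaryTerm w Ω R) (x j) := by
      rw [← mul_sub, ← Finset.sum_sub_distrib, abs_mul, abs_of_nonneg (by positivity)]
      refine mul_le_mul_of_nonneg_left ((Finset.abs_sum_le_sum_abs _ _).trans
        (Finset.sum_le_sum fun j _ => ?_)) (by positivity)
      exact (hw.abs_indicator_sub_smoothing_le hR hΩ (x j)).trans
        (hw.tail_le_smoothing_boundaryTerm hd hR hfr (x j))
    -- The mean of the smoothed indicator is the intermediate quantity: `h1` compares it with the
    -- volume, and `h4` with `h3` compares it with the empirical mean.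
    have h5 := abs_sub_le (volume.real Ω)
      ((m : ℝ)⁻¹ * ∑ j, smoothing w R (Ω.indicator fun _ => (1 : ℝ)) (x j))
      ((m : ℝ)⁻¹ * ∑ j, Ω.indicator (fun _ => (1 : ℝ)) (x j))
    rw [abs_sub_comm] at h1 h4
    simp only [add_mul, Finset.sum_add_distrib]
    have h6 := h3.trans' (le_abs_self _)
    linarith
  -- The torus is connected, so an empty frontier leaves only the empty set and the whole torus,
  -- where the discrepancy is zero.
  · have hlhs : volume.real Ω - (m : ℝ)⁻¹ * ∑ j, Ω.indicator (fun _ => (1 : ℝ)) (x j) = 0 := by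
      rw [Set.not_nonempty_iff_eq_empty, frontier_eq_empty_iff] at hfr
      rcases hfr with rfl | rfl
      · simp
      · have : volume.real (Set.univ : Set (UnitAddTorus (Fin d))) = 1 := by
          rw [← pi_haarAddCircle]; exact probReal_univ
        simp [hm0, this]
    rw [hlhs, abs_zero]
    positivity

end IsProfile

end ErdosTuran

theorem theorem4 (d : ℕ) (hd : 1 ≤ d) :
    (∃ w : EuclideanSpace ℝ (Fin d) → ℝ, ErdosTuran.IsProfile w) ∧
    ∀ w : EuclideanSpace ℝ (Fin d) → ℝ, ErdosTuran.IsProfile w →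
      (∀ t : ℝ, 0 ≤ t → 0 < ErdosTuran.psi w t) ∧
      (∀ α : ℝ, ∃ c : ℝ, ∀ t : ℝ, 0 ≤ t → ErdosTuran.psi w t ≤ c * (1 + t) ^ (-α)) ∧
      ∀ (m : ℕ) (_ : 1 ≤ m) (x : Fin m → UnitAddTorus (Fin d))
        (Ω : Set (UnitAddTorus (Fin d))) (_ : NullMeasurableSet Ω volume) (R : ℝ) (_ : 0 < R),
        |volume.real Ω - (m : ℝ)⁻¹ * ∑ j, Ω.indicator (fun _ => (1 : ℝ)) (x j)| ≤
          ‖ErdosTuran.coeff (ErdosTuran.boundaryTerm w Ω R) 0‖ +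
          ∑ k ∈ ErdosTuran.freqs d R,
            (‖ErdosTuran.coeff (Ω.indicator (fun _ => (1 : ℝ))) k‖ +
              ‖ErdosTuran.coeff (ErdosTuran.boundaryTerm w Ω R) k‖) *
            ‖(m : ℂ)⁻¹ * ∑ j, UnitAddTorus.mFourier k (x j)‖ := by
  refine ⟨ErdosTuran.exists_isProfile d, fun w hw => ⟨fun t _ => hw.psi_pos hd t,
    hw.exists_psi_le, fun m hm x Ω hΩ R hR => hw.abs_volume_sub_mean_le hd hm x hΩ hR⟩⟩
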